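/- All graphs are finite, simple and have at least one vertex; $\overline{X}$ is the complement of $X$, $\overline{K_\alpha}$ is the graph on $\alpha$ vertices without edges, and two vertices $x\neq x'$ are twins if $N(x)=N(x')$. The lexicographic product $X[Y]$ has vertex set $V(X)\times V(Y)$, with $(x,y)\sim(x',y')$ if and only if $xx'\in E(X)$, or $x=x'$ and $yy'\in E(Y)$. A magic unitary is a matrix of self-adjoint projections in a unital $C^*$-algebra all of whose rows and columns sum to $1$. A quantum permutation group on a finite set $S$ is a pair $\mathbb G=(C(\mathbb G),w)$, where $C(\mathbb G)$ is a unital $C^*$-algebra generated by the entries of a magic unitary $w=(w_{ij})_{i,j\in S}$ that admits a comultiplication $\Delta(w_{ij})=\sum_k w_{ik}\otimes w_{kj}$. Two quantum permutation groups on the same set are equal if $w_{ij}\mapsto w'_{ij}$ defines a $*$-isomorphism of their $C^*$-algebras. The quantum automorphism group $\mathrm{Qut}(X)$ is given by the universal unital $C^*$-algebra generated by a magic unitary $w=(w_{ij})_{i,j\in V(X)}$ with $w_{ij}w_{k\ell}=0$ whenever exactly one of $ik$, $j\ell$ is an edge of $X$. For $\mathbb G=(C(\mathbb G),u)$ on $[m]$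 and $\mathbb H=(C(\mathbb H),v)$ on $[n]$, the free wreath product $\mathbb G\wr_*\mathbb H$ is the quantum permutation group on $[n]\times[m]$ whose $C^*$-algebra is the quotient of the unital free product of $n$ copies of $C(\mathbb G)$ and one copy of $C(\mathbb H)$ by the relations $u^{(a)}_{ij}v_{ab}=v_{ab}u^{(a)}_{ij}$, with magic unitary $w_{(a,i)(b,j)}=u^{(a)}_{ij}v_{ab}$. A graph $X$ is quantum vertex-transitive if all entries of the magic unitary of $\mathrm{Qut}(X)$ are nonzero. Graphs $X$ and $Y$ are quantum isomorphic if there is a magic unitary $w=(w_{xy})_{x\in V(X),y\in V(Y)}$ over a nonzero unital $C^*$-algebra with $A_Xw=wA_Y$, where $A_X,A_Y$ are the adjacency matrices. Theorem. Let $X$ and $Y$ be quantum vertex-transitive graphs such that $\mathrm{Qut}(X[Y])\neq\mathrm{Qut}(Y)\wr_*\mathrm{Qut}(X)$ as quantum permutation groups on $V(X)\times V(Y)$, and assume that $\overline{Y}$ is connected. Then there exist 1. an integer $\beta>1$ and connected, pairwise quantum isomorphic, quantum vertex-transitive graphs $Y_1,\dots,Y_\beta$ such that $Y\cong\bigsqcup_{i=1}^{\beta}Y_i$,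 and 2. an integer $\alpha>1$ and a quantum vertex-transitive graph $X'$ without twins such that $X\cong X'[\overline{K_\alpha}]$, such that $$\mathrm{Qut}(X[Y])=\mathrm{Qut}\Bigl(\bigsqcup_{i=1}^{\beta}\overline{K_\alpha}[Y_i]\Bigr)\wr_*\mathrm{Qut}(X'),$$ where the vertex $(x,y)$ of $X[Y]$, with $x$ corresponding to $(p,k)\in V(X')\times[\alpha]$ and $y$ to the vertex $z$ of $Y_i$ under the isomorphisms in 1 and 2, is identified with the pair consisting of $p$ and the vertex $(k,z)$ of $\overline{K_\alpha}[Y_i]$. -/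

import Mathlib

universe u

noncomputable section

/-- A C*-seminorm on a complex *-algebra. -/
structure CStarSeminorm (P : Type u) [Ring P] [StarRing P] [Algebra ℂ P] extends
    Seminorm ℂ P where
  mul_le' : ∀ x y, toFun (x * y) ≤ toFun x * toFun y
  cstar' : ∀ x, toFun x * toFun x ≤ toFun (star x * x)

namespace CStarSeminorm

section Basic

variable {P : Type u} [Ring P] [StarRing P] [Algebra ℂ P]

theorem nonneg (p : CStarSeminorm P) (x : P) : 0 ≤ p.toFun x := apply_nonneg p.toSeminorm x

theorem star_eq (p : CStarSeminorm P) (x : P) : p.toFun (star x) = p.toFun x := by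
  have key : ∀ y : P, p.toFun y ≤ p.toFun (star y) := by
    intro y
    rcases (p.nonneg y).eq_or_lt with h | h
    · rw [← h]; exact p.nonneg _
    · exact le_of_mul_le_mul_right ((p.cstar' y).trans (p.mul_le' _ _)) h
  exact le_antisymm (by simpa using key (star x)) (key x)

/-- The pointwise supremum of a pointwise bounded set of C*-seminorms. -/
def sup (S : Set (CStarSeminorm P))
    (hS : ∀ x, BddAbove {r : ℝ | ∃ p ∈ S, r = p.toFun x}) : CStarSeminorm P where
  toFun x := sSup {r : ℝ | ∃ p ∈ S, r = p.toFun x}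
  map_zero' := by
    apply le_antisymm
    · apply Real.sSup_le _ le_rfl
      rintro r ⟨p, -, rfl⟩
      exact p.map_zero'.le
    · apply Real.sSup_nonneg
      rintro r ⟨p, -, rfl⟩
      exact p.nonneg _
  add_le' x y := by
    apply Real.sSup_le
    · rintro r ⟨p, hp, rfl⟩
      exact (p.add_le' x y).trans
        (add_le_add (le_csSup (hS x) ⟨p, hp, rfl⟩) (le_csSup (hS y) ⟨p, hp, rfl⟩))
    · apply add_nonneg <;>
      · apply Real.sSup_nonneg
        rintro r ⟨p, -, rfl⟩
        exact p.nonneg _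
  neg' x := by
    congr 1
    ext r
    constructor <;>
    · rintro ⟨p, hp, rfl⟩
      exact ⟨p, hp, by first | exact p.neg' x | exact (p.neg' x).symm⟩
  smul' a x := by
    have hset : ∀ z : P, {r : ℝ | ∃ p ∈ S, r = p.toFun z} =
        Set.range (fun p : S => p.1.toFun z) := by
      intro z
      ext r
      constructor
      · rintro ⟨p, hp, rfl⟩
        exact ⟨⟨p, hp⟩, rfl⟩
      · rintro ⟨⟨p, hp⟩, rfl⟩
        exact ⟨p, hp, rfl⟩
    rw [hset, hset, sSup_range, sSup_range, Real.mul_iSup_of_nonneg (norm_nonneg a)]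
    exact iSup_congr fun p => p.1.smul' a x
  mul_le' x y := by
    have h0 : ∀ z : P, 0 ≤ sSup {r : ℝ | ∃ p ∈ S, r = p.toFun z} := by
      intro z
      apply Real.sSup_nonneg
      rintro r ⟨p, -, rfl⟩
      exact p.nonneg _
    apply Real.sSup_le _ (mul_nonneg (h0 x) (h0 y))
    rintro r ⟨p, hp, rfl⟩
    exact (p.mul_le' x y).trans (mul_le_mul (le_csSup (hS x) ⟨p, hp, rfl⟩)
      (le_csSup (hS y) ⟨p, hp, rfl⟩) (p.nonneg _) (h0 x))
  cstar' x := by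
    have h0 : ∀ z : P, 0 ≤ sSup {r : ℝ | ∃ p ∈ S, r = p.toFun z} := by
      intro z
      apply Real.sSup_nonneg
      rintro r ⟨p, -, rfl⟩
      exact p.nonneg _
    rw [← pow_two, ← Real.le_sqrt (h0 _) (h0 _)]
    apply Real.sSup_le _ (Real.sqrt_nonneg _)
    rintro r ⟨p, hp, rfl⟩
    rw [Real.le_sqrt (p.nonneg _) (h0 _), pow_two]
    exact (p.cstar' x).trans (le_csSup (hS _) ⟨p, hp, rfl⟩)

theorem le_sup (S : Set (CStarSeminorm P))
    (hS : ∀ x, BddAbove {r : ℝ | ∃ p ∈ S, r = p.toFun x}) {p : CStarSeminorm P} (hp : p ∈ S)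
    (x : P) : p.toFun x ≤ (sup S hS).toFun x :=
  le_csSup (hS x) ⟨p, hp, rfl⟩

theorem sup_le (S : Set (CStarSeminorm P))
    (hS : ∀ x, BddAbove {r : ℝ | ∃ p ∈ S, r = p.toFun x}) {x : P} {c : ℝ} (hc : 0 ≤ c)
    (h : ∀ p ∈ S, p.toFun x ≤ c) : (sup S hS).toFun x ≤ c := by
  apply Real.sSup_le _ hc
  rintro r ⟨p, hp, rfl⟩
  exact h p hp

/-- The C*-seminorm `x ↦ ‖φ x‖` defined by a *-homomorphism into a C*-algebra. -/
def ofHom {B : Type u} [CStarAlgebra B] (φ : P →⋆ₐ[ℂ] B) : CStarSeminorm P where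
  toFun x := ‖φ x‖
  map_zero' := by simp
  add_le' x y := by simpa using norm_add_le (φ x) (φ y)
  neg' x := by rw [map_neg, norm_neg]
  smul' a x := by simp [norm_smul]
  mul_le' x y := by simpa using norm_mul_le (φ x) (φ y)
  cstar' x := by rw [map_mul, map_star, CStarRing.norm_star_mul_self]

end Basic

section Completion

variable {P : Type u} [Ring P] [StarRing P] [Algebra ℂ P]

/-- The *-algebra `P`, regarded as a seminormed space through the C*-seminorm `p`. -/
def Pre (_p : CStarSeminorm P) : Type u := P

variable (p : CStarSeminorm P)

instance : Ring p.Pre := inferInstanceAs (Ring P)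
instance : StarRing p.Pre := inferInstanceAs (StarRing P)
instance : Algebra ℂ p.Pre := inferInstanceAs (Algebra ℂ P)

/-- The identity map of `P`. -/
def toPre : P ≃+* p.Pre := RingEquiv.refl P

instance : SeminormedRing p.Pre where
  toRing := inferInstance
  __ := (p.toSeminorm.toAddGroupSeminorm.toSeminormedAddCommGroup : SeminormedAddCommGroup P)
  norm_mul_le := p.mul_le'

theorem norm_toPre (x : P) : ‖p.toPre x‖ = p.toFun x := rfl

instance : NormedAlgebra ℂ p.Pre where
  toAlgebra := inferInstance
  norm_smul_le a x := (p.smul' a x).le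

theorem isometry_star_pre : Isometry (star : p.Pre → p.Pre) := by
  apply AddMonoidHomClass.isometry_of_norm (starAddEquiv : p.Pre ≃+ p.Pre)
  exact p.star_eq

/-- The C*-algebra obtained from `P` by dividing out the kernel of the C*-seminorm `p`
and completing. -/
def Completion : Type u := UniformSpace.Completion p.Pre

instance : NormedRing p.Completion := inferInstanceAs (NormedRing (UniformSpace.Completion p.Pre))
instance : CompleteSpace p.Completion :=
  inferInstanceAs (CompleteSpace (UniformSpace.Completion p.Pre))
instance : Algebra ℂ p.Completion :=
  inferInstanceAs (Algebra ℂ (UniformSpace.Completion p.Pre))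
instance : NormedSpace ℂ p.Completion :=
  inferInstanceAs (NormedSpace ℂ (UniformSpace.Completion p.Pre))
instance : NormedAlgebra ℂ p.Completion where
  norm_smul_le := norm_smul_le

/-- The canonical map, as a ring homomorphism. -/
def coeRingHom : P →+* p.Completion :=
  (UniformSpace.Completion.coeRingHom : p.Pre →+* UniformSpace.Completion p.Pre).comp
    (p.toPre : P →+* p.Pre)

theorem norm_coeRingHom (x : P) : ‖p.coeRingHom x‖ = p.toFun x :=
  UniformSpace.Completion.norm_coe (p.toPre x)

theorem coeRingHom_smul (a : ℂ) (x : P) : p.coeRingHom (a • x) = a • p.coeRingHom x :=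
  UniformSpace.Completion.coe_smul a (p.toPre x)

theorem denseRange_coeRingHom : DenseRange p.coeRingHom :=
  UniformSpace.Completion.denseRange_coe (α := p.Pre)

theorem completion_induction {C : p.Completion → Prop} (x : p.Completion)
    (hc : IsClosed {a | C a}) (h : ∀ a : P, C (p.coeRingHom a)) : C x :=
  UniformSpace.Completion.induction_on (α := p.Pre) x hc h

theorem completion_induction₂ {C : p.Completion → p.Completion → Prop} (x y : p.Completion)
    (hc : IsClosed {a : p.Completion × p.Completion | C a.1 a.2})
    (h : ∀ a b : P, C (p.coeRingHom a) (p.coeRingHom b)) : C x y :=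
  UniformSpace.Completion.induction_on₂ (α := p.Pre) (β := p.Pre) x y hc h

instance : Star p.Completion :=
  ⟨UniformSpace.Completion.map (star : p.Pre → p.Pre)⟩

theorem star_coeRingHom (x : P) : star (p.coeRingHom x) = p.coeRingHom (star x) :=
  UniformSpace.Completion.map_coe p.isometry_star_pre.uniformContinuous (p.toPre x)

instance : ContinuousStar p.Completion :=
  ⟨UniformSpace.Completion.continuous_map (f := (star : p.Pre → p.Pre))⟩

instance : StarRing p.Completion where
  star_involutive x := by
    refine p.completion_induction (C := fun x => star (star x) = x) x
      (isClosed_eq (by fun_prop) (by fun_prop)) fun a => ?_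
    rw [star_coeRingHom, star_coeRingHom, star_star]
  star_mul x y := by
    refine p.completion_induction₂ (C := fun x y => star (x * y) = star y * star x) x y
      (isClosed_eq (by fun_prop) (by fun_prop)) fun a b => ?_
    rw [← map_mul, star_coeRingHom, star_coeRingHom, star_coeRingHom, ← map_mul, star_mul]
  star_add x y := by
    refine p.completion_induction₂ (C := fun x y => star (x + y) = star x + star y) x y
      (isClosed_eq (by fun_prop) (by fun_prop)) fun a b => ?_
    rw [← map_add, star_coeRingHom, star_coeRingHom, star_coeRingHom, ← map_add, star_add]

instance [StarModule ℂ P] : CStarAlgebra p.Completion where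
  toNormedRing := inferInstance
  toStarRing := inferInstance
  toCompleteSpace := inferInstance
  toNormedAlgebra := inferInstance
  norm_mul_self_le x := by
    refine p.completion_induction (C := fun x => ‖x‖ * ‖x‖ ≤ ‖star x * x‖) x
      (isClosed_le (by fun_prop) (by fun_prop)) fun a => ?_
    rw [star_coeRingHom, ← map_mul, norm_coeRingHom, norm_coeRingHom]
    exact p.cstar' a
  star_smul a x := by
    have h1 : Continuous fun x : p.Completion => a • x := continuous_const_smul a
    have h2 : Continuous fun x : p.Completion => star a • x := continuous_const_smul (star a)
    refine p.completion_induction (C := fun x => star (a • x) = star a • star x) x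
      (isClosed_eq (continuous_star.comp h1) (h2.comp continuous_star)) fun b => ?_
    rw [← coeRingHom_smul, star_coeRingHom, star_coeRingHom, star_smul, coeRingHom_smul]

/-- The canonical *-homomorphism from `P` into its C*-completion. -/
def toCompletion : P →⋆ₐ[ℂ] p.Completion where
  __ := p.coeRingHom
  commutes' a := by
    change p.coeRingHom (algebraMap ℂ P a) = _
    rw [Algebra.algebraMap_eq_smul_one, coeRingHom_smul, map_one, Algebra.algebraMap_eq_smul_one]
  map_star' x := (p.star_coeRingHom x).symm

theorem norm_toCompletion (x : P) : ‖p.toCompletion x‖ = p.toFun x := p.norm_coeRingHom x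

theorem denseRange_toCompletion : DenseRange p.toCompletion := p.denseRange_coeRingHom

variable {B : Type u} [CStarAlgebra B]

theorem continuous_of_le (φ : P →⋆ₐ[ℂ] B) (h : ∀ x, ‖φ x‖ ≤ p.toFun x) :
    Continuous ((φ : P →+* B).comp (p.toPre.symm : p.Pre →+* P)) :=
  AddMonoidHomClass.continuous_of_bound ((φ : P →+* B).comp (p.toPre.symm : p.Pre →+* P)) 1
    (fun x => by rw [one_mul]; exact h (p.toPre.symm x))

/-- The extension, as a ring homomorphism. -/
def extendRingHom (φ : P →⋆ₐ[ℂ] B) (h : ∀ x, ‖φ x‖ ≤ p.toFun x) : p.Completion →+* B :=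
  UniformSpace.Completion.extensionHom ((φ : P →+* B).comp (p.toPre.symm : p.Pre →+* P))
    (p.continuous_of_le φ h)

theorem extendRingHom_coe (φ : P →⋆ₐ[ℂ] B) (h : ∀ x, ‖φ x‖ ≤ p.toFun x) (x : P) :
    p.extendRingHom φ h (p.coeRingHom x) = φ x :=
  UniformSpace.Completion.extensionHom_coe ((φ : P →+* B).comp (p.toPre.symm : p.Pre →+* P))
    (p.continuous_of_le φ h) (p.toPre x)

theorem continuous_extendRingHom (φ : P →⋆ₐ[ℂ] B) (h : ∀ x, ‖φ x‖ ≤ p.toFun x) :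
    Continuous (p.extendRingHom φ h) :=
  UniformSpace.Completion.continuous_extension

/-- A *-homomorphism into a C*-algebra that is dominated by `p` extends to the C*-completion. -/
def extend (φ : P →⋆ₐ[ℂ] B) (h : ∀ x, ‖φ x‖ ≤ p.toFun x) : p.Completion →⋆ₐ[ℂ] B where
  __ := p.extendRingHom φ h
  commutes' a := by
    have h1 : algebraMap ℂ p.Completion a = p.coeRingHom (algebraMap ℂ P a) :=
      (p.toCompletion.commutes' a).symm
    change p.extendRingHom φ h _ = _
    rw [h1, extendRingHom_coe]
    exact φ.commutes' a
  map_star' x := by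
    change p.extendRingHom φ h (star x) = star (p.extendRingHom φ h x)
    have hc := p.continuous_extendRingHom φ h
    refine p.completion_induction
      (C := fun x => p.extendRingHom φ h (star x) = star (p.extendRingHom φ h x)) x
      (isClosed_eq (by fun_prop) (by fun_prop)) fun a => ?_
    rw [star_coeRingHom, extendRingHom_coe, extendRingHom_coe, map_star]

theorem extend_toCompletion (φ : P →⋆ₐ[ℂ] B) (h : ∀ x, ‖φ x‖ ≤ p.toFun x) (x : P) :
    p.extend φ h (p.toCompletion x) = φ x :=
  p.extendRingHom_coe φ h x

end Completion

end CStarSeminorm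

/-- The free unital complex *-algebra on a set `G` of generators: the words in the letters
`(g, false)` and `(g, true)` form a linear basis, where `(g, true)` is the formal adjoint of
`(g, false)`. -/
def FreeStarAlgebra (G : Type u) : Type u := MonoidAlgebra ℂ (FreeMonoid (G × Bool))

namespace FreeStarAlgebra

variable {G : Type u}

instance : Ring (FreeStarAlgebra G) :=
  inferInstanceAs (Ring (MonoidAlgebra ℂ (FreeMonoid (G × Bool))))
instance : Algebra ℂ (FreeStarAlgebra G) :=
  inferInstanceAs (Algebra ℂ (MonoidAlgebra ℂ (FreeMonoid (G × Bool))))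

/-- The generators and their formal adjoints. -/
def letter (l : G × Bool) : FreeStarAlgebra G :=
  (MonoidAlgebra.of ℂ (FreeMonoid (G × Bool)) (FreeMonoid.of l) :)

/-- The generators. -/
def gen (g : G) : FreeStarAlgebra G := letter (g, false)

@[elab_as_elim]
theorem induction {C : FreeStarAlgebra G → Prop} (x : FreeStarAlgebra G)
    (hone : C 1) (hletter : ∀ l x, C x → C (letter l * x))
    (hadd : ∀ x y, C x → C y → C (x + y)) (hsmul : ∀ (a : ℂ) x, C x → C (a • x)) : C x := by
  refine MonoidAlgebra.induction_on (R := ℂ) (M := FreeMonoid (G × Bool)) (motive := C) x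
    ?_ hadd hsmul
  intro m
  induction m using FreeMonoid.inductionOn' with
  | one => rw [map_one]; exact hone
  | of_mul l m ih => rw [map_mul]; exact hletter l _ ih

/-- The involution, as a ring homomorphism into the opposite ring: it is conjugate linear and
interchanges each generator with its formal adjoint. -/
def starHom (G : Type u) : FreeStarAlgebra G →+* (FreeStarAlgebra G)ᵐᵒᵖ :=
  MonoidAlgebra.liftNCRingHom (k := ℂ) (G := FreeMonoid (G × Bool))
    ((algebraMap ℂ (FreeStarAlgebra G)ᵐᵒᵖ).comp (starRingEnd ℂ))
    (FreeMonoid.lift fun l => MulOpposite.op (letter (l.1, !l.2)))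
    (fun a _ => Algebra.commutes (starRingEnd ℂ a) _)

theorem starHom_letter (l : G × Bool) :
    starHom G (letter l) = MulOpposite.op (letter (l.1, !l.2)) := by
  refine (MonoidAlgebra.liftNC_single _ _ _ _).trans ?_
  simp

theorem starHom_algebraMap (a : ℂ) :
    starHom G (algebraMap ℂ _ a) = algebraMap ℂ _ (starRingEnd ℂ a) := by
  refine (MonoidAlgebra.liftNC_single _ _ _ _).trans ?_
  simp

theorem starHom_smul (a : ℂ) (x : FreeStarAlgebra G) :
    starHom G (a • x) = starRingEnd ℂ a • starHom G x := by
  rw [Algebra.smul_def, map_mul, starHom_algebraMap, ← Algebra.smul_def]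

instance : StarRing (FreeStarAlgebra G) where
  star x := (starHom G x).unop
  star_involutive x := by
    change (starHom G (starHom G x).unop).unop = x
    induction x using induction with
    | hone => simp
    | hletter l x ih => simp [starHom_letter, ih]
    | hadd x y hx hy => simp [hx, hy]
    | hsmul a x hx => simp [starHom_smul, hx]
  star_mul x y := by simp
  star_add x y := by simp

theorem star_def (x : FreeStarAlgebra G) : star x = (starHom G x).unop := rfl

instance : StarModule ℂ (FreeStarAlgebra G) where
  star_smul a x := by simp [star_def, starHom_smul]

theorem star_letter (l : G × Bool) : star (letter l) = letter (l.1, !l.2) := by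
  rw [star_def, starHom_letter, MulOpposite.unop_op]

section Lift

variable {B : Type u} [Ring B] [StarRing B] [Algebra ℂ B]

/-- The evaluation of *-polynomials, as an algebra homomorphism. -/
def liftAlgHom (T : G → B) : FreeStarAlgebra G →ₐ[ℂ] B :=
  MonoidAlgebra.lift ℂ B (FreeMonoid (G × Bool))
    (FreeMonoid.lift fun l => if l.2 then star (T l.1) else T l.1)

theorem liftAlgHom_letter (T : G → B) (l : G × Bool) :
    liftAlgHom T (letter l) = if l.2 then star (T l.1) else T l.1 := by
  refine (MonoidAlgebra.lift_of _ _).trans ?_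
  simp

variable [StarModule ℂ B]

/-- The evaluation of *-polynomials in elements `T g` of a *-algebra. -/
def lift (T : G → B) : FreeStarAlgebra G →⋆ₐ[ℂ] B where
  __ := liftAlgHom T
  map_star' x := by
    change liftAlgHom T (star x) = star (liftAlgHom T x)
    induction x using induction with
    | hone => simp
    | hletter l x ih =>
      rw [star_mul, map_mul, ih, map_mul, star_mul, star_letter, liftAlgHom_letter,
        liftAlgHom_letter]
      rcases l with ⟨g, b⟩
      cases b <;> simp
    | hadd x y hx hy => simp [hx, hy]
    | hsmul a x hx => simp [hx]

theorem lift_letter (T : G → B) (l : G × Bool) :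
    lift T (letter l) = if l.2 then star (T l.1) else T l.1 := liftAlgHom_letter T l

@[simp]
theorem lift_gen (T : G → B) (g : G) : lift T (gen g) = T g := by
  rw [gen, lift_letter]; simp

end Lift

end FreeStarAlgebra

/-- Generators `G` and relations `rels` (each *-polynomial in `rels` is to vanish) for a unital
C*-algebra, such that every generator is uniformly bounded in all representations. -/
structure CStarPresentation (G : Type u) where
  rels : Set (FreeStarAlgebra G)
  bounded : ∀ g : G, ∃ c : ℝ, ∀ (B : Type u) [CStarAlgebra B] (T : G → B),
    (∀ r ∈ rels, FreeStarAlgebra.lift T r = 0) → ‖T g‖ ≤ c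

namespace CStarPresentation

variable {G : Type u} (R : CStarPresentation G)

/-- The C*-seminorms `x ↦ ‖x(T)‖` given by the representations `T` of the presentation in
C*-algebras (equivalently, in algebras of bounded operators on Hilbert spaces). -/
def seminorms : Set (CStarSeminorm (FreeStarAlgebra G)) :=
  {p | ∃ (B : Type u) (_ : CStarAlgebra B) (T : G → B),
    (∀ r ∈ R.rels, FreeStarAlgebra.lift T r = 0) ∧
      p = CStarSeminorm.ofHom (FreeStarAlgebra.lift T)}

theorem bddAbove (x : FreeStarAlgebra G) :
    BddAbove {r : ℝ | ∃ p ∈ R.seminorms, r = p.toFun x} := by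
  suffices h : ∃ c : ℝ, ∀ (B : Type u) (_ : CStarAlgebra B) (T : G → B),
      (∀ r ∈ R.rels, FreeStarAlgebra.lift T r = 0) → ‖FreeStarAlgebra.lift T x‖ ≤ c by
    obtain ⟨c, hc⟩ := h
    refine ⟨c, ?_⟩
    rintro r ⟨p, ⟨B, hB, T, hT, rfl⟩, rfl⟩
    exact hc B hB T hT
  induction x using FreeStarAlgebra.induction with
  | hone =>
    refine ⟨1, fun B hB T hT => ?_⟩
    rw [map_one]
    rcases subsingleton_or_nontrivial B with h | h
    · rw [Subsingleton.elim (1 : B) 0, norm_zero]; exact zero_le_one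
    · exact CStarRing.norm_one.le
  | hletter l x ih =>
    obtain ⟨c, hc⟩ := ih
    obtain ⟨d, hd⟩ := R.bounded l.1
    refine ⟨|d| * |c|, fun B hB T hT => ?_⟩
    rw [map_mul, FreeStarAlgebra.lift_letter]
    refine (norm_mul_le _ _).trans (mul_le_mul ?_ ((hc B hB T hT).trans (le_abs_self c))
      (norm_nonneg _) (abs_nonneg d))
    have := (hd B T hT).trans (le_abs_self d)
    split_ifs
    · rwa [norm_star]
    · exact this
  | hadd x y hx hy =>
    obtain ⟨c, hc⟩ := hx
    obtain ⟨d, hd⟩ := hy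
    refine ⟨c + d, fun B hB T hT => ?_⟩
    rw [map_add]
    exact (norm_add_le _ _).trans (add_le_add (hc B hB T hT) (hd B hB T hT))
  | hsmul a x hx =>
    obtain ⟨c, hc⟩ := hx
    refine ⟨‖a‖ * c, fun B hB T hT => ?_⟩
    rw [map_smul, norm_smul]
    exact mul_le_mul_of_nonneg_left (hc B hB T hT) (norm_nonneg a)

/-- The largest C*-seminorm on the free *-algebra that comes from representations. -/
def seminorm : CStarSeminorm (FreeStarAlgebra G) := CStarSeminorm.sup R.seminorms R.bddAbove

/-- The universal unital C*-algebra with the given generators and relations. -/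
def Univ : Type u := R.seminorm.Completion

instance : CStarAlgebra R.Univ := inferInstanceAs (CStarAlgebra R.seminorm.Completion)

/-- The canonical map from the free *-algebra. -/
def ofFree : FreeStarAlgebra G →⋆ₐ[ℂ] R.Univ := R.seminorm.toCompletion

/-- The generators of the universal C*-algebra. -/
def gen (g : G) : R.Univ := R.ofFree (FreeStarAlgebra.gen g)

theorem ofFree_eq_zero {r : FreeStarAlgebra G} (hr : r ∈ R.rels) : R.ofFree r = 0 := by
  rw [← norm_eq_zero]
  refine (R.seminorm.norm_toCompletion r).trans (le_antisymm ?_ (R.seminorm.nonneg r))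
  refine CStarSeminorm.sup_le _ _ le_rfl ?_
  rintro p ⟨B, hB, T, hT, rfl⟩
  change ‖FreeStarAlgebra.lift T r‖ ≤ 0
  rw [hT r hr, norm_zero]

/-- The universal property. -/
def lift {B : Type u} [CStarAlgebra B] (T : G → B)
    (hT : ∀ r ∈ R.rels, FreeStarAlgebra.lift T r = 0) : R.Univ →⋆ₐ[ℂ] B :=
  R.seminorm.extend (FreeStarAlgebra.lift T) fun x =>
    CStarSeminorm.le_sup R.seminorms R.bddAbove
      (p := CStarSeminorm.ofHom (FreeStarAlgebra.lift T)) ⟨B, _, T, hT, rfl⟩ x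

@[simp]
theorem lift_gen {B : Type u} [CStarAlgebra B] (T : G → B)
    (hT : ∀ r ∈ R.rels, FreeStarAlgebra.lift T r = 0) (g : G) : R.lift T hT (R.gen g) = T g :=
  (R.seminorm.extend_toCompletion _ _ _).trans (FreeStarAlgebra.lift_gen T g)

theorem eq_top_of_gen_mem (S : StarSubalgebra ℂ R.Univ) (hS : IsClosed (S : Set R.Univ))
    (h : ∀ g, R.gen g ∈ S) : S = ⊤ := by
  have h1 : ∀ x, R.ofFree x ∈ S := by
    intro x
    induction x using FreeStarAlgebra.induction with
    | hone => rw [map_one]; exact one_mem S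
    | hletter l x ih =>
      rw [map_mul]
      refine mul_mem ?_ ih
      rcases l with ⟨g, b⟩
      cases b
      · exact h g
      · have : FreeStarAlgebra.letter (g, true) = star (FreeStarAlgebra.gen g) := by
          rw [FreeStarAlgebra.gen, FreeStarAlgebra.star_letter]; rfl
        rw [this, map_star]
        exact star_mem (h g)
    | hadd x y hx hy => rw [map_add]; exact add_mem hx hy
    | hsmul a x hx => rw [map_smul]; exact SMulMemClass.smul_mem a hx
  rw [eq_top_iff]
  intro x _
  exact R.seminorm.completion_induction (C := fun x => x ∈ S) x hS h1

end CStarPresentation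

open scoped TensorProduct

section MinTensor

section HilbertTensor

variable {A B : Type u} [CStarAlgebra A] [CStarAlgebra B]
variable {H K : Type u} [NormedAddCommGroup H] [InnerProductSpace ℂ H] [CompleteSpace H]
  [NormedAddCommGroup K] [InnerProductSpace ℂ K] [CompleteSpace K]

/-- The operators `(π ⊗ ρ)(z)` on the algebraic tensor product of the Hilbert spaces of two
representations. -/
def hilbertTensor (π : A →⋆ₐ[ℂ] (H →L[ℂ] H)) (ρ : B →⋆ₐ[ℂ] (K →L[ℂ] K)) :
    A ⊗[ℂ] B →ₗ[ℂ] (H ⊗[ℂ] K →L[ℂ] H ⊗[ℂ] K) :=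
  TensorProduct.lift (LinearMap.mk₂ ℂ (fun a b => TensorProduct.mapL (π a) (ρ b))
    (fun a a' b => by rw [map_add, TensorProduct.mapL_add_left])
    (fun c a b => by rw [map_smul, TensorProduct.mapL_smul_left])
    (fun a b b' => by rw [map_add, TensorProduct.mapL_add_right])
    (fun c a b => by rw [map_smul, TensorProduct.mapL_smul_right]))

variable (π : A →⋆ₐ[ℂ] (H →L[ℂ] H)) (ρ : B →⋆ₐ[ℂ] (K →L[ℂ] K))

theorem hilbertTensor_tmul (a : A) (b : B) :
    hilbertTensor π ρ (a ⊗ₜ b) = TensorProduct.mapL (π a) (ρ b) := rfl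

theorem hilbertTensor_mul (z w : A ⊗[ℂ] B) :
    hilbertTensor π ρ (z * w) = hilbertTensor π ρ z * hilbertTensor π ρ w := by
  induction z with
  | zero => simp
  | add x y hx hy => simp only [add_mul, map_add, hx, hy]
  | tmul a b =>
    induction w with
    | zero => simp
    | add x y hx hy => simp only [mul_add, map_add, hx, hy]
    | tmul c d =>
      rw [Algebra.TensorProduct.tmul_mul_tmul, hilbertTensor_tmul, hilbertTensor_tmul,
        hilbertTensor_tmul, map_mul, map_mul, TensorProduct.mapL_mul]

theorem inner_hilbertTensor (z : A ⊗[ℂ] B) (x y : H ⊗[ℂ] K) :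
    inner ℂ (hilbertTensor π ρ z x) y = inner ℂ x (hilbertTensor π ρ (star z) y) := by
  induction z with
  | zero => simp
  | add z w hz hw => simp only [star_add, map_add, add_apply, inner_add_left,
      inner_add_right, hz, hw]
  | tmul a b =>
    induction x with
    | zero => simp
    | add x x' hx hx' => simp only [map_add, inner_add_left, hx, hx']
    | tmul h k =>
      induction y with
      | zero => simp
      | add y y' hy hy' => simp only [map_add, inner_add_right, hy, hy']
      | tmul h' k' =>
        rw [TensorProduct.star_tmul, hilbertTensor_tmul, hilbertTensor_tmul,
          TensorProduct.mapL_tmul, TensorProduct.mapL_tmul, TensorProduct.inner_tmul,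
          TensorProduct.inner_tmul, map_star, map_star, ContinuousLinearMap.star_eq_adjoint,
          ContinuousLinearMap.star_eq_adjoint, ContinuousLinearMap.adjoint_inner_right,
          ContinuousLinearMap.adjoint_inner_right]

/-- The C*-seminorm `z ↦ ‖(π ⊗ ρ)(z)‖`. -/
def hilbertTensorSeminorm : CStarSeminorm (A ⊗[ℂ] B) where
  toFun z := ‖hilbertTensor π ρ z‖
  map_zero' := by rw [map_zero]; exact ContinuousLinearMap.opNorm_zero
  add_le' x y := by rw [map_add]; exact ContinuousLinearMap.opNorm_add_le _ _
  neg' x := by rw [map_neg]; exact ContinuousLinearMap.opNorm_neg _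
  smul' a x := by
    have key : ∀ (c : ℂ) (y : A ⊗[ℂ] B),
        ‖hilbertTensor π ρ (c • y)‖ ≤ ‖c‖ * ‖hilbertTensor π ρ y‖ := by
      intro c y
      rw [map_smul]
      exact ContinuousLinearMap.opNorm_smul_le c _
    refine le_antisymm (key a x) ?_
    rcases eq_or_ne a 0 with rfl | ha
    · rw [norm_zero, zero_mul]
      exact ContinuousLinearMap.opNorm_nonneg _
    · have h := key a⁻¹ (a • x)
      rwa [smul_smul, inv_mul_cancel₀ ha, one_smul, norm_inv,
        le_inv_mul_iff₀ (norm_pos_iff.mpr ha)] at h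
  mul_le' x y := by rw [hilbertTensor_mul]; exact ContinuousLinearMap.opNorm_comp_le _ _
  cstar' z := by
    have h0 : ∀ w : A ⊗[ℂ] B, 0 ≤ ‖hilbertTensor π ρ w‖ := fun w =>
      ContinuousLinearMap.opNorm_nonneg _
    rw [← pow_two, ← Real.le_sqrt (h0 _) (h0 _)]
    refine ContinuousLinearMap.opNorm_le_bound _ (Real.sqrt_nonneg _) fun x => ?_
    refine abs_le_of_sq_le_sq' ?_ (by positivity) |>.2
    rw [mul_pow, Real.sq_sqrt (h0 _), ← inner_self_eq_norm_sq (𝕜 := ℂ),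
      inner_hilbertTensor, hilbertTensor_mul]
    refine (re_inner_le_norm (𝕜 := ℂ) x
      (hilbertTensor π ρ (star z) (hilbertTensor π ρ z x))).trans ?_
    rw [pow_two, mul_comm ‖x‖, ← mul_assoc]
    exact mul_le_mul_of_nonneg_right
      ((hilbertTensor π ρ (star z) * hilbertTensor π ρ z).le_opNorm x) (norm_nonneg _)

end HilbertTensor

variable (A B : Type u) [CStarAlgebra A] [CStarAlgebra B]

/-- The C*-seminorms on the algebraic tensor product that come from a pair of representations
on Hilbert spaces. -/
def spatialSeminorms : Set (CStarSeminorm (A ⊗[ℂ] B)) :=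
  {p | ∃ (H : Type u) (_ : NormedAddCommGroup H) (_ : InnerProductSpace ℂ H)
    (_ : CompleteSpace H) (K : Type u) (_ : NormedAddCommGroup K) (_ : InnerProductSpace ℂ K)
    (_ : CompleteSpace K) (π : A →⋆ₐ[ℂ] (H →L[ℂ] H)) (ρ : B →⋆ₐ[ℂ] (K →L[ℂ] K)),
      p = hilbertTensorSeminorm π ρ}

theorem spatialSeminorms_bddAbove (z : A ⊗[ℂ] B) :
    BddAbove {r : ℝ | ∃ p ∈ spatialSeminorms A B, r = p.toFun z} := by
  suffices h : ∃ c : ℝ, ∀ p ∈ spatialSeminorms A B, p.toFun z ≤ c by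
    obtain ⟨c, hc⟩ := h
    refine ⟨c, ?_⟩
    rintro r ⟨p, hp, rfl⟩
    exact hc p hp
  induction z with
  | zero => exact ⟨0, fun p _ => p.map_zero'.le⟩
  | add x y hx hy =>
    obtain ⟨c, hc⟩ := hx
    obtain ⟨d, hd⟩ := hy
    exact ⟨c + d, fun p hp => (p.add_le' x y).trans (add_le_add (hc p hp) (hd p hp))⟩
  | tmul a b =>
    refine ⟨‖a‖ * ‖b‖, ?_⟩
    rintro p ⟨H, _, _, _, K, _, _, _, π, ρ, rfl⟩
    change ‖hilbertTensor π ρ (a ⊗ₜ b)‖ ≤ _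
    rw [hilbertTensor_tmul]
    exact (TensorProduct.norm_mapL_le _ _).trans
      (mul_le_mul (NonUnitalStarAlgHom.norm_apply_le π a) (NonUnitalStarAlgHom.norm_apply_le ρ b)
        (norm_nonneg _) (norm_nonneg _))

/-- The minimal (spatial) C*-norm on the algebraic tensor product. -/
def minSeminorm : CStarSeminorm (A ⊗[ℂ] B) :=
  CStarSeminorm.sup (spatialSeminorms A B) (spatialSeminorms_bddAbove A B)

/-- The minimal (spatial) tensor product of two C*-algebras. -/
def MinTensor : Type u := (minSeminorm A B).Completion

instance : CStarAlgebra (MinTensor A B) :=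
  inferInstanceAs (CStarAlgebra (minSeminorm A B).Completion)

variable {A B}

/-- The canonical map from the algebraic tensor product. -/
def MinTensor.of : A ⊗[ℂ] B →⋆ₐ[ℂ] MinTensor A B := (minSeminorm A B).toCompletion

/-- The elementary tensor `a ⊗ b`. -/
def MinTensor.tmul (a : A) (b : B) : MinTensor A B := MinTensor.of (a ⊗ₜ[ℂ] b)

/-- The embedding `a ↦ a ⊗ 1`. -/
def MinTensor.inl : A →⋆ₐ[ℂ] MinTensor A B :=
  MinTensor.of.comp
    { (Algebra.TensorProduct.includeLeft : A →ₐ[ℂ] A ⊗[ℂ] B) with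
      map_star' := fun a => by
        change (star a) ⊗ₜ[ℂ] (1 : B) = star (a ⊗ₜ[ℂ] (1 : B))
        rw [TensorProduct.star_tmul, star_one] }

/-- The embedding `b ↦ 1 ⊗ b`. -/
def MinTensor.inr : B →⋆ₐ[ℂ] MinTensor A B :=
  MinTensor.of.comp
    { (Algebra.TensorProduct.includeRight : B →ₐ[ℂ] A ⊗[ℂ] B) with
      map_star' := fun b => by
        change (1 : A) ⊗ₜ[ℂ] (star b) = star ((1 : A) ⊗ₜ[ℂ] b)
        rw [TensorProduct.star_tmul, star_one] }

theorem MinTensor.inl_mul_inr (a : A) (b : B) :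
    (MinTensor.inl a * MinTensor.inr b : MinTensor A B) = MinTensor.tmul a b := by
  change MinTensor.of (a ⊗ₜ[ℂ] (1 : B)) * MinTensor.of ((1 : A) ⊗ₜ[ℂ] b) = _
  rw [← map_mul, Algebra.TensorProduct.tmul_mul_tmul, mul_one, one_mul]
  rfl

theorem MinTensor.commute (a : A) (b : B) :
    Commute (MinTensor.inl a : MinTensor A B) (MinTensor.inr b) := by
  change MinTensor.of (a ⊗ₜ[ℂ] (1 : B)) * MinTensor.of ((1 : A) ⊗ₜ[ℂ] b) =
    MinTensor.of ((1 : A) ⊗ₜ[ℂ] b) * MinTensor.of (a ⊗ₜ[ℂ] (1 : B))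
  rw [← map_mul, ← map_mul, Algebra.TensorProduct.tmul_mul_tmul,
    Algebra.TensorProduct.tmul_mul_tmul, mul_one, one_mul, mul_one, one_mul]

variable {C D : Type u} [CStarAlgebra C] [CStarAlgebra D]

/-- The algebraic tensor product of two *-homomorphisms. -/
def algTensorMap (f : A →⋆ₐ[ℂ] C) (g : B →⋆ₐ[ℂ] D) : A ⊗[ℂ] B →⋆ₐ[ℂ] C ⊗[ℂ] D where
  __ := Algebra.TensorProduct.map (f : A →ₐ[ℂ] C) (g : B →ₐ[ℂ] D)
  map_star' z := by
    change Algebra.TensorProduct.map (f : A →ₐ[ℂ] C) (g : B →ₐ[ℂ] D) (star z) =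
      star (Algebra.TensorProduct.map (f : A →ₐ[ℂ] C) (g : B →ₐ[ℂ] D) z)
    induction z with
    | zero => simp
    | add x y hx hy => rw [star_add, map_add, map_add, star_add, hx, hy]
    | tmul a b => simp [TensorProduct.star_tmul, map_star]

theorem hilbertTensor_comp (f : A →⋆ₐ[ℂ] C) (g : B →⋆ₐ[ℂ] D) {H K : Type u}
    [NormedAddCommGroup H] [InnerProductSpace ℂ H] [CompleteSpace H]
    [NormedAddCommGroup K] [InnerProductSpace ℂ K] [CompleteSpace K]
    (π : C →⋆ₐ[ℂ] (H →L[ℂ] H)) (ρ : D →⋆ₐ[ℂ] (K →L[ℂ] K)) (z : A ⊗[ℂ] B) :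
    hilbertTensor π ρ (algTensorMap f g z) = hilbertTensor (π.comp f) (ρ.comp g) z := by
  induction z with
  | zero => simp
  | add x y hx hy => rw [map_add, map_add, hx, hy, map_add]
  | tmul a b => rfl

/-- The tensor product of two *-homomorphisms. -/
def MinTensor.map (f : A →⋆ₐ[ℂ] C) (g : B →⋆ₐ[ℂ] D) : MinTensor A B →⋆ₐ[ℂ] MinTensor C D :=
  (minSeminorm A B).extend (MinTensor.of.comp (algTensorMap f g)) fun z => by
    refine ((minSeminorm C D).norm_toCompletion _).trans_le ?_
    refine CStarSeminorm.sup_le _ _ ((minSeminorm A B).nonneg z) ?_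
    rintro p ⟨H, _, _, _, K, _, _, _, π, ρ, rfl⟩
    change ‖hilbertTensor π ρ (algTensorMap f g z)‖ ≤ _
    rw [hilbertTensor_comp]
    exact CStarSeminorm.le_sup (spatialSeminorms A B) (spatialSeminorms_bddAbove A B)
      (p := hilbertTensorSeminorm (π.comp f) (ρ.comp g))
      ⟨H, _, _, _, K, _, _, _, π.comp f, ρ.comp g, rfl⟩ z

theorem MinTensor.map_tmul (f : A →⋆ₐ[ℂ] C) (g : B →⋆ₐ[ℂ] D) (a : A) (b : B) :
    MinTensor.map f g (MinTensor.tmul a b) = MinTensor.tmul (f a) (g b) :=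
  (minSeminorm A B).extend_toCompletion _ _ _

end MinTensor

/-- A magic unitary: a matrix of self-adjoint projections whose rows and columns sum to `1`. -/
structure IsMagicUnitary {m n A : Type u} [Fintype m] [Fintype n] [CStarAlgebra A]
    (w : Matrix m n A) : Prop where
  mul_self : ∀ i j, w i j * w i j = w i j
  star_eq : ∀ i j, star (w i j) = w i j
  row_sum : ∀ i, ∑ j, w i j = 1
  col_sum : ∀ j, ∑ i, w i j = 1

theorem projection_orthogonal {n A : Type u} [Fintype n] [CStarAlgebra A] (q : n → A)
    (h1 : ∀ i, q i * q i = q i) (h2 : ∀ i, star (q i) = q i) (hsum : ∑ i, q i = 1)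
    {i j : n} (hij : i ≠ j) : q i * q j = 0 := by
  classical
  let _ := CStarAlgebra.spectralOrder A
  have _ := CStarAlgebra.spectralOrderedRing A
  have h3 : ∑ k ∈ Finset.univ.erase j, star (q k * q j) * (q k * q j) = 0 := by
    have h4 : ∑ k, star (q k * q j) * (q k * q j) = q j := by
      have : ∀ k, star (q k * q j) * (q k * q j) = q j * q k * q j := by
        intro k
        rw [star_mul, h2, h2, mul_assoc, ← mul_assoc (q k), h1, mul_assoc]
      simp_rw [this]
      rw [← Finset.sum_mul, ← Finset.mul_sum, hsum, mul_one, h1]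
    rw [← Finset.add_sum_erase _ _ (Finset.mem_univ j)] at h4
    have h5 : star (q j * q j) * (q j * q j) = q j := by rw [h1, h2, h1]
    rw [h5] at h4
    exact add_eq_left.mp h4
  have h6 := (Finset.sum_eq_zero_iff_of_nonneg
    (fun k _ => star_mul_self_nonneg (q k * q j))).mp h3 i
    (Finset.mem_erase.mpr ⟨hij, Finset.mem_univ i⟩)
  exact (CStarRing.star_mul_self_eq_zero_iff _).mp h6

namespace IsMagicUnitary

variable {m n A : Type u} [Fintype m] [Fintype n] [CStarAlgebra A] {w : Matrix m n A}

theorem row_orthogonal (hw : IsMagicUnitary w) (i : m) {j k : n} (h : j ≠ k) :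
    w i j * w i k = 0 :=
  projection_orthogonal (fun j => w i j) (hw.mul_self i) (hw.star_eq i) (hw.row_sum i) h

theorem col_orthogonal (hw : IsMagicUnitary w) (j : n) {i k : m} (h : i ≠ k) :
    w i j * w k j = 0 :=
  projection_orthogonal (fun i => w i j) (fun i => hw.mul_self i j) (fun i => hw.star_eq i j)
    (hw.col_sum j) h

end IsMagicUnitary

/-- A quantum permutation group acting on the finite set `n`: a unital C*-algebra `C` generated
by a magic unitary `w`, with a comultiplication `Δ` such that `Δ(w i j) = ∑ k, w i k ⊗ w k j`.
Such a `Δ` is unique because `w` generates `C`, it is coassociative, and it satisfies the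
cancellation property of a compact quantum group because `w` and its transpose are unitary. -/
structure QuantumPermGroup (n : Type u) [Fintype n] where
  C : Type u
  [cstar : CStarAlgebra C]
  w : Matrix n n C
  magic : IsMagicUnitary w
  generates : ∀ S : StarSubalgebra ℂ C, IsClosed (S : Set C) → (∀ i j, w i j ∈ S) → S = ⊤
  comul : ∃ Δ : C →⋆ₐ[ℂ] MinTensor C C, ∀ i j, Δ (w i j) = ∑ k, MinTensor.tmul (w i k) (w k j)

attribute [instance] QuantumPermGroup.cstar

/-- Equality of the quantum permutation groups `G` on `m` and `H` on `n`, where the points of `m`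
are identified with those of `n` through the bijection `e`: matching the entries of the magic
unitaries defines a *-isomorphism of the C*-algebras. -/
def QuantumPermGroup.Equal {m n : Type u} [Fintype m] [Fintype n] (e : m ≃ n)
    (G : QuantumPermGroup m) (H : QuantumPermGroup n) : Prop :=
  ∃ φ : G.C ≃⋆ₐ[ℂ] H.C, ∀ i j, φ (G.w i j) = H.w (e i) (e j)

section Qut

variable {V : Type u} [Fintype V] (X : SimpleGraph V)

/-- The relations of the quantum automorphism group, for a matrix `w` of elements of a
*-algebra: `w` is a magic unitary and `w i j * w k l = 0` whenever exactly one of `i k` and `j l`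
is an edge. -/
def qutRels {P : Type u} [Ring P] [StarRing P] (w : V → V → P) : Set P :=
  {r | (∃ i j, r = w i j * w i j - w i j) ∨ (∃ i j, r = star (w i j) - w i j) ∨
    (∃ i, r = ∑ j, w i j - 1) ∨ (∃ j, r = ∑ i, w i j - 1) ∨
    (∃ i j k l, X.Adj i k ∧ ¬ X.Adj j l ∧ r = w i j * w k l) ∨
    (∃ i j k l, ¬ X.Adj i k ∧ X.Adj j l ∧ r = w i j * w k l)}

theorem qutRels_iff {B : Type u} [CStarAlgebra B] (T : V × V → B) :
    (∀ r ∈ qutRels X (fun i j => FreeStarAlgebra.gen (i, j)), FreeStarAlgebra.lift T r = 0) ↔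
      IsMagicUnitary (Matrix.of fun i j => T (i, j)) ∧
      (∀ i j k l, X.Adj i k → ¬ X.Adj j l → T (i, j) * T (k, l) = 0) ∧
      (∀ i j k l, ¬ X.Adj i k → X.Adj j l → T (i, j) * T (k, l) = 0) := by
  constructor
  · intro h
    refine ⟨⟨fun i j => ?_, fun i j => ?_, fun i => ?_, fun j => ?_⟩, fun i j k l h1 h2 => ?_,
      fun i j k l h1 h2 => ?_⟩
    · simpa [sub_eq_zero] using h _ (Or.inl ⟨i, j, rfl⟩)
    · simpa [sub_eq_zero, map_star] using h _ (Or.inr (Or.inl ⟨i, j, rfl⟩))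
    · simpa [sub_eq_zero] using h _ (Or.inr (Or.inr (Or.inl ⟨i, rfl⟩)))
    · simpa [sub_eq_zero] using h _ (Or.inr (Or.inr (Or.inr (Or.inl ⟨j, rfl⟩))))
    · simpa using h _ (Or.inr (Or.inr (Or.inr (Or.inr (Or.inl ⟨i, j, k, l, h1, h2, rfl⟩)))))
    · simpa using h _ (Or.inr (Or.inr (Or.inr (Or.inr (Or.inr ⟨i, j, k, l, h1, h2, rfl⟩)))))
  · rintro ⟨hm, h1, h2⟩ r
      (⟨i, j, rfl⟩ | ⟨i, j, rfl⟩ | ⟨i, rfl⟩ | ⟨j, rfl⟩ | ⟨i, j, k, l, h3, h4, rfl⟩ |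
        ⟨i, j, k, l, h3, h4, rfl⟩)
    · simpa [sub_eq_zero] using hm.mul_self i j
    · simpa [sub_eq_zero, map_star] using hm.star_eq i j
    · simpa [sub_eq_zero] using hm.row_sum i
    · simpa [sub_eq_zero] using hm.col_sum j
    · simpa using h1 i j k l h3 h4
    · simpa using h2 i j k l h3 h4

theorem norm_projection_le {B : Type u} [CStarAlgebra B] {x : B} (h1 : x * x = x)
    (h2 : star x = x) : ‖x‖ ≤ 1 := by
  have h3 : ‖x‖ * ‖x‖ = ‖x‖ := by
    rw [← CStarRing.norm_star_mul_self, h2, h1]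
  rcases (norm_nonneg x).eq_or_lt with h | h
  · rw [← h]; exact zero_le_one
  · exact (mul_left_cancel₀ h.ne' (h3.trans (mul_one _).symm)).le

/-- The presentation of `C(Qut(X))`. -/
def qutPresentation : CStarPresentation (V × V) where
  rels := qutRels X fun i j => FreeStarAlgebra.gen (i, j)
  bounded g := by
    refine ⟨1, fun B _ T hT => ?_⟩
    have h := ((qutRels_iff X T).mp hT).1
    exact norm_projection_le (h.mul_self g.1 g.2) (h.star_eq g.1 g.2)

/-- The magic unitary of generators of `C(Qut(X))`. -/
def qutMatrix : Matrix V V (qutPresentation X).Univ :=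
  Matrix.of fun i j => (qutPresentation X).gen (i, j)

theorem lift_gen_eq_ofFree {G : Type u} (R : CStarPresentation G) :
    FreeStarAlgebra.lift R.gen = R.ofFree := by
  ext x
  induction x using FreeStarAlgebra.induction with
  | hone => simp
  | hletter l x ih =>
    rw [map_mul, map_mul, ih, FreeStarAlgebra.lift_letter]
    rcases l with ⟨g, b⟩
    cases b
    · rfl
    · have h : FreeStarAlgebra.letter (g, true) = star (FreeStarAlgebra.gen g) := by
        rw [FreeStarAlgebra.gen, FreeStarAlgebra.star_letter]; rfl
      rw [h, map_star]
      rfl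
  | hadd x y hx hy => simp [hx, hy]
  | hsmul a x hx => simp [hx]

theorem gen_rels {G : Type u} (R : CStarPresentation G) :
    ∀ r ∈ R.rels, FreeStarAlgebra.lift R.gen r = 0 := by
  intro r hr
  rw [lift_gen_eq_ofFree]
  exact R.ofFree_eq_zero hr

theorem sum_tmul_magic {n A : Type u} [Fintype n] [CStarAlgebra A] {w : Matrix n n A}
    (hw : IsMagicUnitary w) :
    IsMagicUnitary (Matrix.of fun i j => ∑ k, MinTensor.tmul (w i k) (w k j)) := by
  classical
  have ht : ∀ i j, (∑ k, MinTensor.tmul (w i k) (w k j) : MinTensor A A) =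
      ∑ k, MinTensor.inl (w i k) * MinTensor.inr (w k j) := fun i j =>
    Finset.sum_congr rfl fun k _ => (MinTensor.inl_mul_inr _ _).symm
  refine ⟨fun i j => ?_, fun i j => ?_, fun i => ?_, fun j => ?_⟩
  · simp only [Matrix.of_apply]
    rw [ht, Finset.sum_mul]
    refine Finset.sum_congr rfl fun k _ => ?_
    rw [Finset.mul_sum, Finset.sum_eq_single k]
    · rw [mul_assoc, ← mul_assoc (MinTensor.inr (w k j)), ← (MinTensor.commute _ _).eq,
        mul_assoc, ← map_mul, hw.mul_self, ← mul_assoc, ← map_mul, hw.mul_self]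
    · intro l _ hl
      rw [mul_assoc, ← mul_assoc (MinTensor.inr (w k j)), ← (MinTensor.commute _ _).eq,
        mul_assoc, ← map_mul, ← mul_assoc, ← map_mul, hw.row_orthogonal i hl.symm, map_zero,
        zero_mul]
    · exact fun h => absurd (Finset.mem_univ k) h
  · simp only [Matrix.of_apply]
    rw [ht, star_sum]
    refine Finset.sum_congr rfl fun k _ => ?_
    rw [star_mul, ← map_star, ← map_star, hw.star_eq, hw.star_eq, (MinTensor.commute _ _).eq]
  · simp only [Matrix.of_apply, ht]
    rw [Finset.sum_comm]
    simp only [← Finset.mul_sum, ← map_sum, hw.row_sum, map_one, mul_one]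
  · simp only [Matrix.of_apply, ht]
    rw [Finset.sum_comm]
    simp only [← Finset.sum_mul, ← map_sum, hw.col_sum, map_one, one_mul]

theorem sum_tmul_mul_eq_zero {n A : Type u} [Fintype n] [CStarAlgebra A] {w : Matrix n n A}
    {i j k l : n} (h : ∀ a b, w i a * w k b = 0 ∨ w a j * w b l = 0) :
    (∑ a, MinTensor.tmul (w i a) (w a j) : MinTensor A A) *
      ∑ b, MinTensor.tmul (w k b) (w b l) = 0 := by
  rw [Finset.sum_mul]
  refine Finset.sum_eq_zero fun a _ => ?_
  rw [Finset.mul_sum]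
  refine Finset.sum_eq_zero fun b _ => ?_
  rw [← MinTensor.inl_mul_inr, ← MinTensor.inl_mul_inr, mul_assoc,
    ← mul_assoc (MinTensor.inr (w a j)), ← (MinTensor.commute _ _).eq, mul_assoc, ← map_mul,
    ← mul_assoc, ← map_mul]
  rcases h a b with h | h <;> rw [h, map_zero]
  · rw [zero_mul]
  · rw [mul_zero]

/-- The quantum automorphism group of a finite graph: the universal unital C*-algebra generated
by a magic unitary `w` indexed by the vertices with `w i j * w k l = 0` whenever exactly one of
`i k` and `j l` is an edge. -/
def Qut : QuantumPermGroup V where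
  C := (qutPresentation X).Univ
  w := qutMatrix X
  magic := ((qutRels_iff X _).mp (gen_rels (qutPresentation X))).1
  generates S hS h := (qutPresentation X).eq_top_of_gen_mem S hS fun g => h g.1 g.2
  comul := by
    obtain ⟨hm, h1, h2⟩ := (qutRels_iff X _).mp (gen_rels (qutPresentation X))
    let w := qutMatrix X
    have hw : ∀ i j, w i j = (qutPresentation X).gen (i, j) := fun _ _ => rfl
    refine ⟨(qutPresentation X).lift
      (fun g => ∑ k, MinTensor.tmul (w g.1 k) (w k g.2)) ((qutRels_iff X _).mpr
        ⟨sum_tmul_magic hm, fun i j k l h3 h4 => ?_, fun i j k l h3 h4 => ?_⟩), fun i j => ?_⟩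
    · refine sum_tmul_mul_eq_zero fun a b => ?_
      by_cases hab : X.Adj a b
      · exact Or.inr (h1 _ _ _ _ hab h4)
      · exact Or.inl (h1 _ _ _ _ h3 hab)
    · refine sum_tmul_mul_eq_zero fun a b => ?_
      by_cases hab : X.Adj a b
      · exact Or.inl (h2 _ _ _ _ h3 hab)
      · exact Or.inr (h2 _ _ _ _ hab h4)
    · exact (qutPresentation X).lift_gen _ _ _

end Qut

section FreeWreath

/-- The relations saying that `f` is a unital *-homomorphism: the multiplication table of `A`. -/
def tableRels {A P : Type u} [CStarAlgebra A] [Ring P] [StarRing P] [Algebra ℂ P] (f : A → P) :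
    Set P :=
  {r | (∃ x y, r = f (x + y) - (f x + f y)) ∨ (∃ (c : ℂ) (x : A), r = f (c • x) - c • f x) ∨
    (∃ x y, r = f (x * y) - f x * f y) ∨ (∃ x, r = f (star x) - star (f x)) ∨ r = f 1 - 1}

/-- The map `T` is a unital *-homomorphism. -/
structure IsUnitalStarHom {A B : Type u} [CStarAlgebra A] [CStarAlgebra B] (T : A → B) :
    Prop where
  add : ∀ x y, T (x + y) = T x + T y
  smul : ∀ (c : ℂ) x, T (c • x) = c • T x
  mul : ∀ x y, T (x * y) = T x * T y
  star : ∀ x, T (star x) = star (T x)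
  one : T 1 = 1

/-- The bundled *-homomorphism. -/
def IsUnitalStarHom.toHom {A B : Type u} [CStarAlgebra A] [CStarAlgebra B] {T : A → B}
    (h : IsUnitalStarHom T) : A →⋆ₐ[ℂ] B where
  toFun := T
  map_one' := h.one
  map_mul' := h.mul
  map_zero' := by simpa using h.smul 0 0
  map_add' := h.add
  commutes' c := by rw [Algebra.algebraMap_eq_smul_one, h.smul, h.one,
    Algebra.algebraMap_eq_smul_one]
  map_star' := h.star

theorem StarAlgHom.isUnitalStarHom {A B : Type u} [CStarAlgebra A] [CStarAlgebra B]
    (φ : A →⋆ₐ[ℂ] B) : IsUnitalStarHom φ :=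
  ⟨map_add φ, map_smul φ, map_mul φ, map_star φ, map_one φ⟩

theorem tableRels_iff {G A B : Type u} [CStarAlgebra A] [CStarAlgebra B] (e : A → G) (T : G → B) :
    (∀ r ∈ tableRels (fun x => FreeStarAlgebra.gen (e x)), FreeStarAlgebra.lift T r = 0) ↔
      IsUnitalStarHom fun x => T (e x) := by
  constructor
  · intro h
    refine ⟨fun x y => ?_, fun c x => ?_, fun x y => ?_, fun x => ?_, ?_⟩
    · simpa [sub_eq_zero] using h _ (Or.inl ⟨x, y, rfl⟩)
    · simpa [sub_eq_zero] using h _ (Or.inr (Or.inl ⟨c, x, rfl⟩))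
    · simpa [sub_eq_zero] using h _ (Or.inr (Or.inr (Or.inl ⟨x, y, rfl⟩)))
    · simpa [sub_eq_zero, map_star] using h _ (Or.inr (Or.inr (Or.inr (Or.inl ⟨x, rfl⟩))))
    · simpa [sub_eq_zero] using h _ (Or.inr (Or.inr (Or.inr (Or.inr rfl))))
  · rintro h r (⟨x, y, rfl⟩ | ⟨c, x, rfl⟩ | ⟨x, y, rfl⟩ | ⟨x, rfl⟩ | rfl)
    · simpa [sub_eq_zero] using h.add x y
    · simpa [sub_eq_zero] using h.smul c x
    · simpa [sub_eq_zero] using h.mul x y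
    · simpa [sub_eq_zero, map_star] using h.star x
    · simpa [sub_eq_zero] using h.one

variable {m n : Type u} [Fintype m] [Fintype n] (G : QuantumPermGroup m) (H : QuantumPermGroup n)

/-- The generators of the free wreath product: one copy of `C(G)` for each point of `n`, and one
copy of `C(H)`. -/
abbrev WreathGen : Type u := (n × G.C) ⊕ H.C

/-- The relations of the free wreath product: those of the unital free product of `n` copies of
`C(G)` and of `C(H)`, and the commutation of the entries of the `a`-th copy of the magic unitary
of `G` with the entries of the `a`-th row of the magic unitary of `H`. -/
def wreathRels : Set (FreeStarAlgebra (WreathGen G H)) :=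
  {r | (∃ a : n, r ∈ tableRels fun x : G.C => FreeStarAlgebra.gen (Sum.inl (a, x))) ∨
    (r ∈ tableRels fun y : H.C => FreeStarAlgebra.gen (Sum.inr y)) ∨
    ∃ (a b : n) (i j : m),
      r = FreeStarAlgebra.gen (Sum.inl (a, G.w i j)) * FreeStarAlgebra.gen (Sum.inr (H.w a b)) -
        FreeStarAlgebra.gen (Sum.inr (H.w a b)) * FreeStarAlgebra.gen (Sum.inl (a, G.w i j))}

theorem wreathRels_iff {B : Type u} [CStarAlgebra B] (T : WreathGen G H → B) :
    (∀ r ∈ wreathRels G H, FreeStarAlgebra.lift T r = 0) ↔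
      (∀ a, IsUnitalStarHom fun x => T (Sum.inl (a, x))) ∧
      (IsUnitalStarHom fun y => T (Sum.inr y)) ∧
      ∀ a b i j, Commute (T (Sum.inl (a, G.w i j))) (T (Sum.inr (H.w a b))) := by
  constructor
  · intro h
    refine ⟨fun a => ?_, ?_, fun a b i j => ?_⟩
    · exact (tableRels_iff (fun x => Sum.inl (a, x)) T).mp fun r hr => h r (Or.inl ⟨a, hr⟩)
    · exact (tableRels_iff (fun y => Sum.inr y) T).mp fun r hr => h r (Or.inr (Or.inl hr))
    · have := h _ (Or.inr (Or.inr ⟨a, b, i, j, rfl⟩))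
      rwa [map_sub, map_mul, map_mul, FreeStarAlgebra.lift_gen, FreeStarAlgebra.lift_gen,
        sub_eq_zero] at this
  · rintro ⟨h1, h2, h3⟩ r (⟨a, hr⟩ | hr | ⟨a, b, i, j, rfl⟩)
    · exact (tableRels_iff (fun x => Sum.inl (a, x)) T).mpr (h1 a) r hr
    · exact (tableRels_iff (fun y => Sum.inr y) T).mpr h2 r hr
    · rw [map_sub, map_mul, map_mul, FreeStarAlgebra.lift_gen, FreeStarAlgebra.lift_gen,
        sub_eq_zero]
      exact h3 a b i j

/-- The presentation of the C*-algebra of the free wreath product. -/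
def wreathPresentation : CStarPresentation (WreathGen G H) where
  rels := wreathRels G H
  bounded g := by
    rcases g with ⟨a, x⟩ | y
    · refine ⟨‖x‖, fun B _ T hT => ?_⟩
      exact NonUnitalStarAlgHom.norm_apply_le (((wreathRels_iff G H T).mp hT).1 a).toHom x
    · refine ⟨‖y‖, fun B _ T hT => ?_⟩
      exact NonUnitalStarAlgHom.norm_apply_le ((wreathRels_iff G H T).mp hT).2.1.toHom y

theorem wreath_gen_rels :
    (∀ a, IsUnitalStarHom fun x => (wreathPresentation G H).gen (Sum.inl (a, x))) ∧
      (IsUnitalStarHom fun y => (wreathPresentation G H).gen (Sum.inr y)) ∧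
      ∀ a b i j, Commute ((wreathPresentation G H).gen (Sum.inl (a, G.w i j)))
        ((wreathPresentation G H).gen (Sum.inr (H.w a b))) :=
  (wreathRels_iff G H _).mp (gen_rels (wreathPresentation G H))

/-- The embedding of the `a`-th copy of `C(G)`. -/
def wreathInl (a : n) : G.C →⋆ₐ[ℂ] (wreathPresentation G H).Univ :=
  ((wreath_gen_rels G H).1 a).toHom

/-- The embedding of `C(H)`. -/
def wreathInr : H.C →⋆ₐ[ℂ] (wreathPresentation G H).Univ :=
  (wreath_gen_rels G H).2.1.toHom

theorem wreath_commute (a b : n) (i j : m) :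
    Commute (wreathInl G H a (G.w i j)) (wreathInr G H (H.w a b)) :=
  (wreath_gen_rels G H).2.2 a b i j

/-- The magic unitary of the free wreath product, with entries `u⁽ᵃ⁾ i j * v a b`. -/
def wreathMatrix : Matrix (n × m) (n × m) (wreathPresentation G H).Univ :=
  Matrix.of fun p q => wreathInl G H p.1 (G.w p.2 q.2) * wreathInr G H (H.w p.1 q.1)

theorem wreathMatrix_apply (a b : n) (i j : m) :
    wreathMatrix G H (a, i) (b, j) = wreathInl G H a (G.w i j) * wreathInr G H (H.w a b) := rfl

theorem wreathMatrix_magic : IsMagicUnitary (wreathMatrix G H) where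
  mul_self := by
    rintro ⟨a, i⟩ ⟨b, j⟩
    rw [wreathMatrix_apply, mul_assoc, ← mul_assoc (wreathInr G H _),
      ← (wreath_commute G H a b i j).eq, mul_assoc, ← map_mul, H.magic.mul_self, ← mul_assoc,
      ← map_mul, G.magic.mul_self]
  star_eq := by
    rintro ⟨a, i⟩ ⟨b, j⟩
    rw [wreathMatrix_apply, star_mul, ← map_star, ← map_star, G.magic.star_eq, H.magic.star_eq,
      (wreath_commute G H a b i j).eq]
  row_sum := by
    rintro ⟨a, i⟩
    rw [Fintype.sum_prod_type]
    simp only [wreathMatrix_apply, ← Finset.sum_mul, ← map_sum, G.magic.row_sum, map_one, one_mul,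
      H.magic.row_sum]
  col_sum := by
    rintro ⟨b, j⟩
    rw [Fintype.sum_prod_type]
    simp only [wreathMatrix_apply, ← Finset.sum_mul, ← map_sum, G.magic.col_sum, map_one, one_mul,
      H.magic.col_sum]

theorem wreathInl_eq_sum (a : n) (i j : m) :
    wreathInl G H a (G.w i j) = ∑ b, wreathMatrix G H (a, i) (b, j) := by
  simp only [wreathMatrix_apply, ← Finset.mul_sum, ← map_sum, H.magic.row_sum, map_one, mul_one]

theorem wreathInr_eq_sum (a b : n) (i : m) :
    wreathInr G H (H.w a b) = ∑ j, wreathMatrix G H (a, i) (b, j) := by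
  simp only [wreathMatrix_apply, ← Finset.sum_mul, ← map_sum, G.magic.row_sum, map_one, one_mul]

/-- A closed *-subalgebra of the target contains the image of a *-homomorphism from `C(G)` as soon
as it contains the images of the entries of the magic unitary. -/
theorem QuantumPermGroup.map_mem {k : Type u} [Fintype k] (K : QuantumPermGroup k) {B : Type u}
    [CStarAlgebra B] (φ : K.C →⋆ₐ[ℂ] B) (S : StarSubalgebra ℂ B) (hS : IsClosed (S : Set B))
    (h : ∀ i j, φ (K.w i j) ∈ S) (x : K.C) : φ x ∈ S := by
  have hφ : Continuous φ := AddMonoidHomClass.continuous_of_bound φ 1 fun x => by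
    rw [one_mul]; exact NonUnitalStarAlgHom.norm_apply_le φ x
  have h1 := K.generates (S.comap φ) (hS.preimage hφ) h
  have h2 : x ∈ S.comap φ := by rw [h1]; exact StarSubalgebra.mem_top
  exact h2

theorem wreath_generates [Nonempty m] (S : StarSubalgebra ℂ (wreathPresentation G H).Univ)
    (hS : IsClosed (S : Set (wreathPresentation G H).Univ))
    (h : ∀ p q, wreathMatrix G H p q ∈ S) : S = ⊤ := by
  refine (wreathPresentation G H).eq_top_of_gen_mem S hS ?_
  rintro (⟨a, x⟩ | y)
  · refine G.map_mem (wreathInl G H a) S hS (fun i j => ?_) x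
    rw [wreathInl_eq_sum]
    exact sum_mem fun b _ => h _ _
  · refine H.map_mem (wreathInr G H) S hS (fun a b => ?_) y
    rw [wreathInr_eq_sum G H a b (Classical.arbitrary m)]
    exact sum_mem fun j _ => h _ _

theorem QuantumPermGroup.commute_map {k : Type u} [Fintype k] (K : QuantumPermGroup k)
    {B : Type u} [CStarAlgebra B] (φ : K.C →⋆ₐ[ℂ] B) {q : B} (hq : star q = q)
    (h : ∀ i j, Commute q (φ (K.w i j))) (x : K.C) : Commute q (φ x) := by
  have h1 : ∀ y : B, y ∈ StarSubalgebra.centralizer ℂ ({q} : Set B) ↔ Commute q y := by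
    intro y
    rw [StarSubalgebra.mem_centralizer_iff]
    constructor
    · intro hy
      exact (hy q rfl).1
    · rintro hy g rfl
      exact ⟨hy, by rw [hq]; exact hy⟩
  rw [← h1]
  refine K.map_mem φ _ ?_ (fun i j => (h1 _).mpr (h i j)) x
  have h2 : ((StarSubalgebra.centralizer ℂ ({q} : Set B) : StarSubalgebra ℂ B) : Set B) =
      {y | q * y = y * q} := by
    ext y
    exact h1 y
  rw [h2]
  exact isClosed_eq (by fun_prop) (by fun_prop)

theorem wreath_comul : ∃ Δ : (wreathPresentation G H).Univ →⋆ₐ[ℂ]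
      MinTensor (wreathPresentation G H).Univ (wreathPresentation G H).Univ,
    ∀ p q, Δ (wreathMatrix G H p q) =
      ∑ r, MinTensor.tmul (wreathMatrix G H p r) (wreathMatrix G H r q) := by
  classical
  obtain ⟨ΔG, hΔG⟩ := G.comul
  obtain ⟨ΔH, hΔH⟩ := H.comul
  let W := (wreathPresentation G H).Univ
  let l : W →⋆ₐ[ℂ] MinTensor W W := MinTensor.inl
  let r : W →⋆ₐ[ℂ] MinTensor W W := MinTensor.inr
  have hlr : ∀ x y, Commute (l x) (r y) := MinTensor.commute
  let u : n → m → m → W := fun a i j => wreathInl G H a (G.w i j)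
  let v : n → n → W := fun a b => wreathInr G H (H.w a b)
  have huv : ∀ a b i j, Commute (u a i j) (v a b) := wreath_commute G H
  have hv1 : ∀ a b, v a b * v a b = v a b := fun a b => by
    rw [← map_mul, H.magic.mul_self]
  have hv2 : ∀ a b, star (v a b) = v a b := fun a b => by rw [← map_star, H.magic.star_eq]
  have hv3 : ∀ a b c, b ≠ c → v a b * v a c = 0 := fun a b c h => by
    rw [← map_mul, H.magic.row_orthogonal a h, map_zero]
  have hv4 : ∀ a, ∑ b, v a b = 1 := fun a => by rw [← map_sum, H.magic.row_sum, map_one]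
  let D : n → n → G.C →⋆ₐ[ℂ] MinTensor W W := fun a c =>
    (MinTensor.map (wreathInl G H a) (wreathInl G H c)).comp ΔG
  have hD : ∀ a c i j, D a c (G.w i j) = ∑ k, l (u a i k) * r (u c k j) := fun a c i j => by
    change MinTensor.map _ _ (ΔG (G.w i j)) = _
    rw [hΔG, map_sum]
    refine Finset.sum_congr rfl fun k _ => ?_
    rw [MinTensor.map_tmul]
    exact (MinTensor.inl_mul_inr _ _).symm
  let E : H.C →⋆ₐ[ℂ] MinTensor W W := (MinTensor.map (wreathInr G H) (wreathInr G H)).comp ΔH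
  have hE : ∀ a b, E (H.w a b) = ∑ c, l (v a c) * r (v c b) := fun a b => by
    change MinTensor.map _ _ (ΔH (H.w a b)) = _
    rw [hΔH, map_sum]
    refine Finset.sum_congr rfl fun k _ => ?_
    rw [MinTensor.map_tmul]
    exact (MinTensor.inl_mul_inr _ _).symm
  have hlD : ∀ a b c x, Commute (l (v a b)) (D a c x) := fun a b c x => by
    refine G.commute_map (D a c) (by rw [← map_star, hv2]) (fun i j => ?_) x
    rw [hD]
    refine Commute.sum_right _ _ _ fun k _ => Commute.mul_right ?_ (hlr _ _)
    exact ((huv a b i k).map l).symm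
  have hrD : ∀ a b c i j, Commute (r (v c b)) (D a c (G.w i j)) := fun a b c i j => by
    rw [hD]
    refine Commute.sum_right _ _ _ fun k _ => Commute.mul_right (hlr _ _).symm ?_
    exact ((huv c b k j).map r).symm
  let F : n → G.C → MinTensor W W := fun a x => ∑ c, l (v a c) * D a c x
  have hF : ∀ a, IsUnitalStarHom (F a) := fun a => by
    refine ⟨fun x y => ?_, fun c x => ?_, fun x y => ?_, fun x => ?_, ?_⟩
    · simp only [F, map_add, mul_add, Finset.sum_add_distrib]
    · simp only [F, map_smul, mul_smul_comm, Finset.smul_sum]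
    · simp only [F, map_mul]
      rw [Finset.sum_mul]
      refine Finset.sum_congr rfl fun c _ => ?_
      rw [Finset.mul_sum, Finset.sum_eq_single c]
      · rw [mul_assoc (l _), ← mul_assoc (D a c x), ← (hlD a c c x).eq, mul_assoc (l _),
          ← mul_assoc (l _) (l _), ← map_mul l, hv1]
      · intro d _ hd
        rw [mul_assoc (l _), ← mul_assoc (D a c x), ← (hlD a d c x).eq, mul_assoc (l _),
          ← mul_assoc (l _) (l _), ← map_mul l, hv3 a c d hd.symm, map_zero, zero_mul]
      · exact fun h => absurd (Finset.mem_univ c) h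
    · simp only [F]
      rw [star_sum]
      refine Finset.sum_congr rfl fun c _ => ?_
      rw [star_mul, ← map_star, ← map_star, hv2, (hlD a c c _).eq]
    · simp only [F, map_one, mul_one, ← map_sum, hv4]
  have hleft : ∀ a b i j, F a (G.w i j) * E (H.w a b) =
      ∑ c, l (v a c) * (D a c (G.w i j) * r (v c b)) := fun a b i j => by
    simp only [F]
    rw [hE, Finset.sum_mul]
    refine Finset.sum_congr rfl fun c _ => ?_
    rw [Finset.mul_sum, Finset.sum_eq_single c]
    · rw [mul_assoc (l _), ← mul_assoc (D a c _), ← (hlD a c c _).eq, mul_assoc (l _),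
        ← mul_assoc (l _) (l _), ← map_mul l, hv1]
    · intro d _ hd
      rw [mul_assoc (l _), ← mul_assoc (D a c _), ← (hlD a d c _).eq, mul_assoc (l _),
        ← mul_assoc (l _) (l _), ← map_mul l, hv3 a c d hd.symm, map_zero, zero_mul]
    · exact fun h => absurd (Finset.mem_univ c) h
  have hright : ∀ a b i j, E (H.w a b) * F a (G.w i j) =
      ∑ c, l (v a c) * (D a c (G.w i j) * r (v c b)) := fun a b i j => by
    simp only [F]
    rw [hE, Finset.sum_mul]
    refine Finset.sum_congr rfl fun c _ => ?_
    rw [Finset.mul_sum, Finset.sum_eq_single c]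
    · rw [mul_assoc (l _), ← mul_assoc (r _), ← (hlr _ _).eq, mul_assoc (l _),
        ← mul_assoc (l _) (l _), ← map_mul l, hv1, (hrD a b c i j).eq]
    · intro d _ hd
      rw [mul_assoc (l _), ← mul_assoc (r _), ← (hlr _ _).eq, mul_assoc (l _),
        ← mul_assoc (l _) (l _), ← map_mul l, hv3 a c d hd.symm, map_zero, zero_mul]
    · exact fun h => absurd (Finset.mem_univ c) h
  let T : WreathGen G H → MinTensor W W := Sum.elim (fun g => F g.1 g.2) E
  have hT := (wreathRels_iff G H T).mpr ⟨hF, E.isUnitalStarHom, fun a b i j =>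
    (hleft a b i j).trans (hright a b i j).symm⟩
  refine ⟨(wreathPresentation G H).lift T hT, ?_⟩
  rintro ⟨a, i⟩ ⟨b, j⟩
  have h1 : (wreathPresentation G H).lift T hT (wreathInl G H a (G.w i j)) = F a (G.w i j) :=
    (wreathPresentation G H).lift_gen T hT (Sum.inl (a, G.w i j))
  have h2 : (wreathPresentation G H).lift T hT (wreathInr G H (H.w a b)) = E (H.w a b) :=
    (wreathPresentation G H).lift_gen T hT (Sum.inr (H.w a b))
  rw [wreathMatrix_apply, map_mul, h1, h2, hleft, Fintype.sum_prod_type]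
  refine Finset.sum_congr rfl fun c _ => ?_
  rw [hD, Finset.sum_mul, Finset.mul_sum]
  refine Finset.sum_congr rfl fun k _ => ?_
  rw [wreathMatrix_apply, wreathMatrix_apply, ← MinTensor.inl_mul_inr]
  change l (v a c) * (l (u a i k) * r (u c k j) * r (v c b)) =
    l (u a i k * v a c) * r (u c k j * v c b)
  rw [(huv a c i k).eq, map_mul, map_mul]
  simp only [mul_assoc]

/-- The free wreath product of the quantum permutation groups `G` on `m` and `H` on `n`. -/
def freeWreath [Nonempty m] : QuantumPermGroup (n × m) where
  C := (wreathPresentation G H).Univ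
  w := wreathMatrix G H
  magic := wreathMatrix_magic G H
  generates := wreath_generates G H
  comul := wreath_comul G H

end FreeWreath

section Graphs

/-- The lexicographic product `X[Y]`. -/
def lexProd {V W : Type*} (X : SimpleGraph V) (Y : SimpleGraph W) : SimpleGraph (V × W) where
  Adj p q := X.Adj p.1 q.1 ∨ (p.1 = q.1 ∧ Y.Adj p.2 q.2)
  symm := ⟨fun _ _ h => h.imp (fun h => h.symm) fun h => ⟨h.1.symm, h.2.symm⟩⟩
  loopless := ⟨fun _ h => h.elim (fun h => h.ne rfl) fun h => h.2.ne rfl⟩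

/-- The disjoint union of a family of graphs. -/
def disjUnion {ι : Type*} {U : ι → Type*} (Y : ∀ i, SimpleGraph (U i)) :
    SimpleGraph (Σ i, U i) where
  Adj p q := ∃ (i : ι) (x y : U i), p = ⟨i, x⟩ ∧ q = ⟨i, y⟩ ∧ (Y i).Adj x y
  symm := ⟨fun _ _ ⟨i, x, y, hp, hq, h⟩ => ⟨i, y, x, hq, hp, h.symm⟩⟩
  loopless := ⟨by
    rintro _ ⟨i, x, y, rfl, hq, h⟩
    obtain rfl := eq_of_heq (Sigma.mk.inj hq).2
    exact h.ne rfl⟩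

/-- Distinct vertices have distinct neighbourhoods. -/
def HasNoTwins {V : Type*} (X : SimpleGraph V) : Prop :=
  ∀ x y, X.neighborSet x = X.neighborSet y → x = y

/-- All vertices lie in a single orbit of the quantum automorphism group. -/
def IsQuantumVertexTransitive {V : Type u} [Fintype V] (X : SimpleGraph V) : Prop :=
  ∀ x y, (Qut X).w x y ≠ 0

open Classical in
/-- Quantum isomorphism of graphs: there is a magic unitary `w` with entries in a nonzero unital
C*-algebra that intertwines the adjacency matrices. -/
def QuantumIsomorphic {V W : Type u} [Fintype V] [Fintype W] (X : SimpleGraph V)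
    (Y : SimpleGraph W) : Prop :=
  ∃ (A : Type u) (_ : CStarAlgebra A) (w : Matrix V W A),
    Nontrivial A ∧ IsMagicUnitary w ∧ X.adjMatrix A * w = w * Y.adjMatrix A

/-- The bijection `((p, k), (i, z)) ↦ (p, (i, (k, z)))`. -/
def regroup (P K : Type*) {ι : Type*} (U : ι → Type*) :
    (P × K) × (Σ i, U i) ≃ P × (Σ i, K × U i) where
  toFun t := (t.1.1, ⟨t.2.1, (t.1.2, t.2.2)⟩)
  invFun t := ((t.1, t.2.2.1), ⟨t.2.1, t.2.2.2⟩)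
  left_inv _ := rfl
  right_inv _ := rfl

end Graphs

end

/-! Let w be the magic unitary of Qut(X[Y]). A pair of relations is preserved by w when `w i j * w k
l ≠ 0` forces them to agree on (i, k) and (j, l). Preserved relations behave like those of a
coherent configuration: they are closed under Boolean operations, composition and reflexive
transitive closure, and even the numbers of two-step paths agree (`Preserves.card_comp`). So
whatever is definable from adjacency in these terms is respected by quantum automorphisms.

The central fact is `equal_freeWreath`: if w preserves the fibres of a lexicographic product, then
Qut is the free wreath product. Sums over fibres give an action v on the base, the sums over b of w
(a,i) (b,j) give an action u⁽ᵃ⁾ on the fibre factor for each a, and w is their product.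

As the complement of Y is connected, the fibres over the twin classes of X are always preserved
(`preserves_lexProd_twin`). Indeed X is regular, of degree d say, and nonadjacent vertices of X[Y]
with at least d|Y| common neighbours lie over equal or twin vertices of X; the equivalence classes
generated by this relation are exactly the twin fibres.

If X had no twins, these would be the fibres over single vertices. If Y were connected, the latter
would be the connected pieces of the adjacency inside the twin fibres, since twins are not adjacent
(`preserves_lexProd_fst_of_connected`). Either way `equal_freeWreath` contradicts the hypothesis, so
X has twins and Y is disconnected. Quantum transitivity makes the twin classes equally large, so X
is a blow-up of its graph X' of twin classes, and the blocks of Qut(Y) between components are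
quantum isomorphisms. Regrouping turns X[Y] into a lexicographic product over X' whose fibres are
the twin fibres, and `equal_freeWreath` applies once more. -/

/-! ### Calculus of relations preserved by a magic unitary. -/

/-- The relation `R` on the rows corresponds to the relation `R'` on the columns under `w`. -/
def Preserves {S T A : Type u} [CStarAlgebra A] (w : Matrix S T A) (R : S → S → Prop)
    (R' : T → T → Prop) : Prop :=
  ∀ i j k l, w i j * w k l ≠ 0 → (R i k ↔ R' j l)

namespace Preserves

variable {S T A : Type u} [CStarAlgebra A] {w : Matrix S T A}
  {R R₁ : S → S → Prop} {R' R₁' : T → T → Prop}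

theorem not (h : Preserves w R R') : Preserves w (fun i k => ¬ R i k) (fun j l => ¬ R' j l) :=
  fun i j k l hw => not_congr (h i j k l hw)

theorem and (h : Preserves w R R') (h₁ : Preserves w R₁ R₁') :
    Preserves w (fun i k => R i k ∧ R₁ i k) (fun j l => R' j l ∧ R₁' j l) :=
  fun i j k l hw => and_congr (h i j k l hw) (h₁ i j k l hw)

theorem or (h : Preserves w R R') (h₁ : Preserves w R₁ R₁') :
    Preserves w (fun i k => R i k ∨ R₁ i k) (fun j l => R' j l ∨ R₁' j l) :=
  fun i j k l hw => or_congr (h i j k l hw) (h₁ i j k l hw)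

theorem of_iff {Q : S → S → Prop} {Q' : T → T → Prop} (h : Preserves w R R')
    (h1 : ∀ i k, Q i k ↔ R i k) (h2 : ∀ j l, Q' j l ↔ R' j l) : Preserves w Q Q' :=
  fun i j k l hw => (h1 i k).trans ((h i j k l hw).trans (h2 j l).symm)

theorem mul_eq_zero_left (h : Preserves w R R') {i j k l} (h1 : R i k) (h2 : ¬ R' j l) :
    w i j * w k l = 0 := by
  by_contra h0
  exact h2 ((h _ _ _ _ h0).mp h1)

theorem mul_eq_zero_right (h : Preserves w R R') {i j k l} (h1 : ¬ R i k) (h2 : R' j l) :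
    w i j * w k l = 0 := by
  by_contra h0
  exact h1 ((h _ _ _ _ h0).mpr h2)

theorem transpose (h : Preserves w R R') : Preserves w.transpose R' R :=
  fun j i l k hw => (h i j k l hw).symm

variable [Fintype S] [Fintype T]

theorem eq (hw : IsMagicUnitary w) : Preserves w Eq Eq := by
  intro i j k l h
  constructor
  · rintro rfl
    by_contra hjl
    exact h (hw.row_orthogonal i hjl)
  · rintro rfl
    by_contra hik
    exact h (hw.col_orthogonal j hik)

open Classical in
/-- Numbers of paths of length two with steps of given kinds are preserved. -/
theorem card_comp (hw : IsMagicUnitary w) (h : Preserves w R R') (h₁ : Preserves w R₁ R₁')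
    {i j k l} (h0 : w i j * w k l ≠ 0) :
    (Finset.univ.filter fun s => R i s ∧ R₁ s k).card =
      (Finset.univ.filter fun t => R' j t ∧ R₁' t l).card := by
  -- The same triple products are summed in two orders. Here the row sums remove `w s t` and leave
  -- the number of admissible s; in `hT` the column sums leave the number of admissible t.
  have hS : ∑ s, ∑ t, (if R i s ∧ R₁ s k then w i j * w s t * w k l else 0) =
      (Finset.univ.filter fun s => R i s ∧ R₁ s k).card • (w i j * w k l) := by
    rw [← Finset.sum_const, Finset.sum_filter]
    refine Finset.sum_congr rfl fun s _ => ?_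
    split_ifs
    · rw [← Finset.sum_mul, ← Finset.mul_sum, hw.row_sum, mul_one]
    · simp
  have hT : ∑ s, ∑ t, (if R' j t ∧ R₁' t l then w i j * w s t * w k l else 0) =
      (Finset.univ.filter fun t => R' j t ∧ R₁' t l).card • (w i j * w k l) := by
    rw [← Finset.sum_const, Finset.sum_filter, Finset.sum_comm]
    refine Finset.sum_congr rfl fun s _ => ?_
    split_ifs
    · rw [← Finset.sum_mul, ← Finset.mul_sum, hw.col_sum, mul_one]
    · simp
  have hST : ∑ s, ∑ t, (if R i s ∧ R₁ s k then w i j * w s t * w k l else 0) =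
      ∑ s, ∑ t, (if R' j t ∧ R₁' t l then w i j * w s t * w k l else 0) := by
    refine Finset.sum_congr rfl fun s _ => Finset.sum_congr rfl fun t _ => ?_
    -- In a nonzero triple product both pairs of neighbouring factors are nonzero, so the two path
    -- conditions agree term by term.
    by_cases hz : w i j * w s t * w k l = 0
    · simp [hz]
    · have e1 := h i j s t (left_ne_zero_of_mul hz)
      have e2 := h₁ s t k l (right_ne_zero_of_mul (by rwa [mul_assoc] at hz))
      rw [if_congr (and_congr e1 e2) rfl rfl]
  -- A complex multiple of the nonzero element `w i j * w k l` determines its coefficient.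
  rw [hS, hT, ← Nat.cast_smul_eq_nsmul ℂ, ← Nat.cast_smul_eq_nsmul ℂ] at hST
  exact_mod_cast smul_left_injective ℂ h0 hST

theorem comp (hw : IsMagicUnitary w) (h : Preserves w R R') (h₁ : Preserves w R₁ R₁') :
    Preserves w (fun i k => ∃ s, R i s ∧ R₁ s k) (fun j l => ∃ t, R' j t ∧ R₁' t l) := by
  classical
  intro i j k l h0
  have hc := card_comp hw h h₁ h0
  have e1 : (∃ s, R i s ∧ R₁ s k) ↔ (Finset.univ.filter fun s => R i s ∧ R₁ s k).card ≠ 0 := by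
    simp [Finset.filter_eq_empty_iff]
  have e2 : (∃ t, R' j t ∧ R₁' t l) ↔
      (Finset.univ.filter fun t => R' j t ∧ R₁' t l).card ≠ 0 := by
    simp [Finset.filter_eq_empty_iff]
  exact e1.trans (by rw [hc]; exact e2.symm)

theorem reflTransGen (hw : IsMagicUnitary w) (h : Preserves w R R') :
    Preserves w (Relation.ReflTransGen R) (Relation.ReflTransGen R') := by
  -- The closure is treated one path length at a time, so that `comp` serves as the induction step.
  -- A path of length n is a function on all of ℕ whose values beyond n do not matter.
  have key : ∀ n : ℕ, Preserves w
      (fun i k => ∃ (f : ℕ → S), f 0 = i ∧ f n = k ∧ ∀ m < n, R (f m) (f (m + 1)))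
      (fun i k => ∃ (f : ℕ → T), f 0 = i ∧ f n = k ∧ ∀ m < n, R' (f m) (f (m + 1))) := by
    have step : ∀ {U : Type u} (Q : U → U → Prop) (n : ℕ) (i k : U),
        (∃ (f : ℕ → U), f 0 = i ∧ f (n + 1) = k ∧ ∀ m < n + 1, Q (f m) (f (m + 1))) ↔
        ∃ s, (∃ (f : ℕ → U), f 0 = i ∧ f n = s ∧ ∀ m < n, Q (f m) (f (m + 1))) ∧ Q s k := by
      intro U Q n i k
      constructor
      · rintro ⟨f, h0, h1, h2⟩
        exact ⟨f n, ⟨f, h0, rfl, fun m hm => h2 m (by omega)⟩, h1 ▸ h2 n (by omega)⟩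
      · rintro ⟨s, ⟨f, h0, h1, h2⟩, hs⟩
        refine ⟨fun m => if m ≤ n then f m else k, by simp [h0], by simp, fun m hm => ?_⟩
        rcases (Nat.lt_succ_iff.mp hm).eq_or_lt with rfl | hm'
        · simpa [h1] using hs
        · simpa [hm'.le, Nat.succ_le_of_lt hm'] using h2 m hm'
    intro n
    induction n with
    | zero =>
      have h0 : ∀ {U : Type u} (Q : U → U → Prop) (i k : U),
          (∃ (f : ℕ → U), f 0 = i ∧ f 0 = k ∧ ∀ m < 0, Q (f m) (f (m + 1))) ↔ i = k :=
        fun Q i k => ⟨by rintro ⟨f, rfl, rfl, -⟩; rfl, by rintro rfl; exact ⟨fun _ => i, by simp⟩⟩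
      exact (Preserves.eq hw).of_iff (h0 R) (h0 R')
    | succ n ih => exact (comp hw ih h).of_iff (step R n) (step R' n)
  have hiff : ∀ {U : Type u} (Q : U → U → Prop) (i k : U), Relation.ReflTransGen Q i k ↔
      ∃ n, ∃ (f : ℕ → U), f 0 = i ∧ f n = k ∧ ∀ m < n, Q (f m) (f (m + 1)) := by
    intro U Q i k
    constructor
    · intro hQ
      induction hQ with
      | refl => exact ⟨0, fun _ => i, by simp⟩
      | @tail b c _ hbc ih =>
        obtain ⟨n, f, h0, h1, h2⟩ := ih
        refine ⟨n + 1, fun m => if m ≤ n then f m else c, by simp [h0], by simp, fun m hm => ?_⟩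
        rcases (Nat.lt_succ_iff.mp hm).eq_or_lt with rfl | hm'
        · simpa [h1] using hbc
        · simpa [hm'.le, Nat.succ_le_of_lt hm'] using h2 m hm'
    · rintro ⟨n, f, rfl, rfl, h2⟩
      clear h
      induction n with
      | zero => exact .refl
      | succ n ih => exact (ih fun m hm => h2 m (by omega)).tail (h2 n (by omega))
  intro i j k l h0
  rw [hiff, hiff]
  exact exists_congr fun n => key n i j k l h0

end Preserves

theorem IsMagicUnitary.transpose {S T A : Type u} [Fintype S] [Fintype T] [CStarAlgebra A]
    {w : Matrix S T A} (hw : IsMagicUnitary w) : IsMagicUnitary w.transpose :=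
  ⟨fun i j => hw.mul_self j i, fun i j => hw.star_eq j i, hw.col_sum, hw.row_sum⟩

/-! ### Block sums and the quotient of a magic unitary by a preserved equivalence. -/

section Blocks

open Classical in
/-- The sum of the entries of a row over a block of columns. -/
noncomputable def rowBlock {S T A J : Type u} [Fintype T] [CStarAlgebra A] (w : Matrix S T A) (g : T → J)
    (i : S) (d : J) : A :=
  ∑ j with g j = d, w i j

variable {S T A I J : Type u} [Fintype T] [CStarAlgebra A] {w : Matrix S T A}
  {f : S → I} {g : T → J}

theorem rowBlock_mul_entry_eq_zero
    (h : Preserves w (fun i k => f i = f k) (fun j l => g j = g l)) {i i' : S} {j : T} {d : J}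
    (hi : f i = f i') (hj : g j ≠ d) : rowBlock w g i d * w i' j = 0 := by
  classical
  rw [rowBlock, Finset.sum_mul]
  refine Finset.sum_eq_zero fun j' hj' => ?_
  rw [Finset.mem_filter] at hj'
  exact h.mul_eq_zero_left hi fun h' => hj (h'.symm.trans hj'.2)

theorem sum_rowBlock [Fintype J] (w : Matrix S T A) (g : T → J) (i : S) :
    ∑ d, rowBlock w g i d = ∑ j, w i j := by
  classical
  exact Finset.sum_fiberwise _ _ _

/-- A nonzero product of two block sums contains a nonzero product of entries, and these entries
have the same classes as the chosen representatives. -/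
theorem quotient_preserves {σ : I → S} (hσ : ∀ c, f (σ c) = c) {R : I → I → Prop}
    {R' : J → J → Prop} (h : Preserves w (fun i k => R (f i) (f k)) (fun j l => R' (g j) (g l))) :
    Preserves (Matrix.of fun c d => rowBlock w g (σ c) d) R R' := by
  classical
  intro c d c' d' h0
  simp only [Matrix.of_apply, rowBlock, Finset.sum_mul] at h0
  obtain ⟨j, hj, h1⟩ := Finset.exists_ne_zero_of_sum_ne_zero h0
  rw [Finset.mul_sum] at h1
  obtain ⟨l, hl, h2⟩ := Finset.exists_ne_zero_of_sum_ne_zero h1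
  have := h _ _ _ _ h2
  beta_reduce at this
  rwa [hσ, hσ, (Finset.mem_filter.mp hj).2, (Finset.mem_filter.mp hl).2] at this

variable [Fintype S]

theorem rowBlock_star (hw : IsMagicUnitary w) (i : S) (d : J) :
    star (rowBlock w g i d) = rowBlock w g i d := by
  simp [rowBlock, star_sum, hw.star_eq]

/-- The whole row sums to 1, and its entries outside the block annihilate `w i' j`; so the block
alone already acts as a unit. -/
theorem rowBlock_mul_entry (hw : IsMagicUnitary w)
    (h : Preserves w (fun i k => f i = f k) (fun j l => g j = g l)) {i i' : S} {j : T} {d : J}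
    (hi : f i = f i') (hj : g j = d) : rowBlock w g i d * w i' j = w i' j := by
  classical
  have h1 : (∑ j', w i j') * w i' j = w i' j := by rw [hw.row_sum, one_mul]
  conv_rhs => rw [← h1]
  rw [rowBlock, Finset.sum_filter, Finset.sum_mul, Finset.sum_mul]
  refine Finset.sum_congr rfl fun j' _ => ?_
  split_ifs with hd
  · rfl
  · rw [zero_mul, h.mul_eq_zero_left hi]
    rwa [hj]

theorem entry_mul_rowBlock (hw : IsMagicUnitary w)
    (h : Preserves w (fun i k => f i = f k) (fun j l => g j = g l)) {i i' : S} {j : T} {d : J}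
    (hi : f i = f i') (hj : g j = d) : w i' j * rowBlock w g i d = w i' j := by
  have := congrArg star (rowBlock_mul_entry hw h hi hj)
  rwa [star_mul, rowBlock_star hw, hw.star_eq] at this

theorem entry_mul_rowBlock_eq_zero (hw : IsMagicUnitary w)
    (h : Preserves w (fun i k => f i = f k) (fun j l => g j = g l)) {i i' : S} {j : T} {d : J}
    (hi : f i = f i') (hj : g j ≠ d) : w i' j * rowBlock w g i d = 0 := by
  have := congrArg star (rowBlock_mul_entry_eq_zero h hi hj)
  rwa [star_mul, rowBlock_star hw, hw.star_eq, star_zero] at this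

theorem rowBlock_mul_rowBlock (hw : IsMagicUnitary w)
    (h : Preserves w (fun i k => f i = f k) (fun j l => g j = g l)) {i i' : S} (d : J)
    (hi : f i = f i') : rowBlock w g i d * rowBlock w g i' d = rowBlock w g i' d := by
  classical
  conv_lhs => rw [rowBlock, rowBlock]
  rw [← rowBlock, Finset.mul_sum]
  exact Finset.sum_congr rfl fun j hj => rowBlock_mul_entry hw h hi (Finset.mem_filter.mp hj).2

/-- For block sums p and p' of equivalent rows, p p' = p' and p' p = p. The adjoint of the second
equation reads p p' = p. -/
theorem rowBlock_congr (hw : IsMagicUnitary w)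
    (h : Preserves w (fun i k => f i = f k) (fun j l => g j = g l)) {i i' : S} (d : J)
    (hi : f i = f i') : rowBlock w g i d = rowBlock w g i' d := by
  have h1 := congrArg star (rowBlock_mul_rowBlock hw h d hi.symm)
  rw [star_mul, rowBlock_star hw, rowBlock_star hw, rowBlock_mul_rowBlock hw h d hi] at h1
  exact h1.symm

/-- The product of the row block and the column block equals each factor: the row block is a left
unit for the entries of the column block, and the column block is a right unit for those of the row
block. -/
theorem rowBlock_eq_colBlock (hw : IsMagicUnitary w)
    (h : Preserves w (fun i k => f i = f k) (fun j l => g j = g l)) (i : S) (j : T) :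
    rowBlock w g i (g j) = rowBlock w.transpose f j (f i) := by
  classical
  have h1 : rowBlock w g i (g j) * rowBlock w.transpose f j (f i) =
      rowBlock w.transpose f j (f i) := by
    conv_lhs => rw [rowBlock.eq_def w.transpose]
    rw [Finset.mul_sum]
    exact Finset.sum_congr rfl fun k hk =>
      rowBlock_mul_entry hw h (Finset.mem_filter.mp hk).2.symm rfl
  have h2 : rowBlock w g i (g j) * rowBlock w.transpose f j (f i) = rowBlock w g i (g j) := by
    conv_lhs => rw [rowBlock.eq_def w]
    rw [Finset.sum_mul]
    exact Finset.sum_congr rfl fun k hk =>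
      entry_mul_rowBlock hw.transpose h.transpose (Finset.mem_filter.mp hk).2.symm rfl
  rw [← h2, h1]

theorem quotient_magic [Fintype I] [Fintype J] (hw : IsMagicUnitary w)
    (h : Preserves w (fun i k => f i = f k) (fun j l => g j = g l)) {σ : I → S}
    (hσ : ∀ c, f (σ c) = c) {τ : J → T} (hτ : ∀ d, g (τ d) = d) :
    IsMagicUnitary (Matrix.of fun c d => rowBlock w g (σ c) d) where
  mul_self c d := rowBlock_mul_rowBlock hw h d rfl
  star_eq c d := rowBlock_star hw _ _
  row_sum c := (sum_rowBlock w g _).trans (hw.row_sum _)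
  col_sum d := by
    -- Read as column blocks of the single column `τ d`, the summands add up to an ordinary column
    -- sum.
    have h1 : ∀ c, rowBlock w g (σ c) d = rowBlock w.transpose f (τ d) c := fun c => by
      have := rowBlock_eq_colBlock hw h (σ c) (τ d)
      rwa [hσ, hτ] at this
    simp only [Matrix.of_apply, h1]
    exact (sum_rowBlock w.transpose f _).trans (hw.col_sum _)

end Blocks

/-! ### Universal property of Qut and a criterion for equality. -/

section QutUniversal

theorem qut_preserves {V : Type u} [Fintype V] (X : SimpleGraph V) :
    Preserves (Qut X).w X.Adj X.Adj := by
  obtain ⟨-, h1, h2⟩ := (qutRels_iff X _).mp (gen_rels (qutPresentation X))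
  intro i j k l h0
  constructor
  · intro h
    by_contra h'
    exact h0 (h1 i j k l h h')
  · intro h
    by_contra h'
    exact h0 (h2 i j k l h' h)

theorem qut_lift {V B : Type u} [Fintype V] [CStarAlgebra B] (X : SimpleGraph V)
    {w : Matrix V V B} (hw : IsMagicUnitary w) (h : Preserves w X.Adj X.Adj) :
    ∃ φ : (Qut X).C →⋆ₐ[ℂ] B, ∀ i j, φ ((Qut X).w i j) = w i j :=
  ⟨(qutPresentation X).lift (fun p => w p.1 p.2) ((qutRels_iff X _).mpr
    ⟨hw, fun _ _ _ _ h1 h2 => h.mul_eq_zero_left h1 h2,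
      fun _ _ _ _ h1 h2 => h.mul_eq_zero_right h1 h2⟩),
    fun _ _ => (qutPresentation X).lift_gen _ _ _⟩

/-- A zero entry of the universal magic unitary would be mapped to a zero entry of `w`, so one model
with nonzero entries suffices. -/
theorem isQuantumVertexTransitive_of {V B : Type u} [Fintype V] [CStarAlgebra B]
    {X : SimpleGraph V} {w : Matrix V V B} (hw : IsMagicUnitary w) (h : Preserves w X.Adj X.Adj)
    (h0 : ∀ i j, w i j ≠ 0) : IsQuantumVertexTransitive X := by
  obtain ⟨φ, hφ⟩ := qut_lift X hw h
  intro i j hij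
  exact h0 i j (by rw [← hφ, hij, map_zero])

/-- The set on which two *-homomorphisms agree is a closed *-subalgebra, and the entries of the
magic unitary generate. -/
theorem QuantumPermGroup.hom_ext {k B : Type u} [Fintype k] [CStarAlgebra B]
    (K : QuantumPermGroup k) {φ ψ : K.C →⋆ₐ[ℂ] B} (h : ∀ i j, φ (K.w i j) = ψ (K.w i j))
    (x : K.C) : φ x = ψ x := by
  have hc : ∀ φ : K.C →⋆ₐ[ℂ] B, Continuous φ := fun φ =>
    AddMonoidHomClass.continuous_of_bound φ 1 fun x => by
      rw [one_mul]; exact NonUnitalStarAlgHom.norm_apply_le φ x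
  have h1 := K.generates (StarAlgHom.equalizer φ ψ) (isClosed_eq (hc φ) (hc ψ)) h
  have h2 : x ∈ StarAlgHom.equalizer φ ψ := by rw [h1]; exact StarSubalgebra.mem_top
  exact h2

theorem QuantumPermGroup.equal_of_homs {m n : Type u} [Fintype m] [Fintype n] {e : m ≃ n}
    {G : QuantumPermGroup m} {H : QuantumPermGroup n} (φ : G.C →⋆ₐ[ℂ] H.C)
    (ψ : H.C →⋆ₐ[ℂ] G.C) (hφ : ∀ i j, φ (G.w i j) = H.w (e i) (e j))
    (hψ : ∀ i j, ψ (H.w (e i) (e j)) = G.w i j) : G.Equal e H := by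
  refine ⟨StarAlgEquiv.ofBijective φ ⟨?_, ?_⟩, hφ⟩
  · refine Function.LeftInverse.injective (g := ψ) fun x => ?_
    exact G.hom_ext (φ := ψ.comp φ) (ψ := StarAlgHom.id ℂ G.C)
      (fun i j => by simp [hφ, hψ]) x
  · refine Function.RightInverse.surjective (g := ψ) fun x => ?_
    refine H.hom_ext (φ := φ.comp ψ) (ψ := StarAlgHom.id ℂ H.C) (fun i j => ?_) x
    obtain ⟨i, rfl⟩ := e.surjective i
    obtain ⟨j, rfl⟩ := e.surjective j
    simp [hφ, hψ]

end QutUniversal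

/-! ### Fibre-preserving lexicographic products and free wreath products. -/

section Wreath

variable {P Q : Type u} [Fintype P] [Fintype Q]

/-- By the commutation relations, the product of two entries can be written with v a b * v c d in
the middle, so it vanishes unless this pair respects adjacency and equality in X. If a = c and b =
d, it can also be written with u⁽ᵃ⁾ i j * u⁽ᵃ⁾ k l in the middle, which takes care of Y. -/
theorem wreathMatrix_preserves (X : SimpleGraph P) (Y : SimpleGraph Q) :
    Preserves (wreathMatrix (Qut Y) (Qut X)) (lexProd X Y).Adj (lexProd X Y).Adj := by
  rintro ⟨a, i⟩ ⟨b, j⟩ ⟨c, k⟩ ⟨d, l⟩ h0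
  rw [wreathMatrix_apply, wreathMatrix_apply] at h0
  have hc := (wreath_commute (Qut Y) (Qut X) c d k l).eq
  have hv : (Qut X).w a b * (Qut X).w c d ≠ 0 := by
    intro h
    apply h0
    rw [hc, mul_assoc, ← mul_assoc (wreathInr _ _ _), ← map_mul, h, map_zero, zero_mul, mul_zero]
  have h1 := qut_preserves X a b c d hv
  have h2 := Preserves.eq (Qut X).magic a b c d hv
  change (X.Adj a c ∨ (a = c ∧ Y.Adj i k)) ↔ (X.Adj b d ∨ (b = d ∧ Y.Adj j l))
  rw [h1, h2]
  refine or_congr Iff.rfl (and_congr_right fun hbd => ?_)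
  have hac := h2.mpr hbd
  subst hac hbd
  apply qut_preserves Y i j k l
  intro h
  apply h0
  rw [(wreath_commute (Qut Y) (Qut X) a b i j).eq, mul_assoc,
    ← mul_assoc (wreathInl _ _ _ _), ← map_mul, h, map_zero, zero_mul, mul_zero]

/-- If the quantum automorphism group of a lexicographic product preserves the fibres, then it is
the free wreath product of the quantum automorphism groups of the factors. -/
theorem equal_freeWreath [Nonempty Q] {S : Type u} [Fintype S] (Z : SimpleGraph S)
    (X : SimpleGraph P) (Y : SimpleGraph Q) (e : Z ≃g lexProd X Y)
    (h : Preserves (Qut Z).w (fun i k => (e i).1 = (e k).1) (fun j l => (e j).1 = (e l).1)) :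
    (Qut Z).Equal e.toEquiv (freeWreath (Qut Y) (Qut X)) := by
  classical
  let w : Matrix (P × Q) (P × Q) (Qut Z).C := (Qut Z).w.submatrix e.symm e.symm
  have hw : IsMagicUnitary w := by
    refine ⟨fun i j => (Qut Z).magic.mul_self _ _, fun i j => (Qut Z).magic.star_eq _ _,
      fun i => ?_, fun j => ?_⟩
    · exact (e.symm.toEquiv.sum_comp fun k => (Qut Z).w (e.symm i) k).trans
        ((Qut Z).magic.row_sum _)
    · exact (e.symm.toEquiv.sum_comp fun k => (Qut Z).w k (e.symm j)).trans
        ((Qut Z).magic.col_sum _)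
  have hZ : Preserves w (lexProd X Y).Adj (lexProd X Y).Adj := fun i j k l h0 => by
    have := qut_preserves Z _ _ _ _ h0
    rwa [e.symm.map_adj_iff, e.symm.map_adj_iff] at this
  have hB : Preserves w (fun p q => Prod.fst p = Prod.fst q) (fun p q => p.1 = q.1) :=
    fun i j k l h0 => by simpa using h _ _ _ _ h0
  -- Adjacency of the base points is adjacency in the product between different fibres, a Boolean
  -- combination of preserved relations.
  have hX : Preserves w (fun p q => X.Adj (Prod.fst p) (Prod.fst q))
      (fun p q => X.Adj (Prod.fst p) (Prod.fst q)) := by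
    have : ∀ p q : P × Q, X.Adj p.1 q.1 ↔ (lexProd X Y).Adj p q ∧ ¬ p.1 = q.1 := fun p q =>
      ⟨fun h => ⟨Or.inl h, h.ne⟩, fun h => h.1.resolve_right fun h' => h.2 h'.1⟩
    exact (hZ.and hB.not).of_iff this this
  let i₀ : Q := Classical.arbitrary Q
  let v : Matrix P P (Qut Z).C := Matrix.of fun a b => rowBlock w Prod.fst (a, i₀) b
  have hv : ∀ a b i, v a b = rowBlock w Prod.fst (a, i) b := fun a b i =>
    rowBlock_congr hw hB b rfl
  have hvm : IsMagicUnitary v :=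
    quotient_magic hw hB (σ := fun a => (a, i₀)) (fun _ => rfl) (τ := fun b => (b, i₀))
      fun _ => rfl
  have hvX : Preserves v X.Adj X.Adj :=
    quotient_preserves (σ := fun a => (a, i₀)) (fun _ => rfl) hX
  -- In the free wreath product these sums recover the a-th copy of the fibre action, because the
  -- rows of v sum to 1 (compare `wreathInl_eq_sum`).
  let u : P → Matrix Q Q (Qut Z).C := fun a => Matrix.of fun i j => ∑ b, w (a, i) (b, j)
  have hum : ∀ a, IsMagicUnitary (u a) := by
    intro a
    refine ⟨fun i j => ?_, fun i j => ?_, fun i => ?_, fun j => ?_⟩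
    · change (∑ b, w (a, i) (b, j)) * (∑ b, w (a, i) (b, j)) = ∑ b, w (a, i) (b, j)
      rw [Finset.sum_mul]
      refine Finset.sum_congr rfl fun b _ => ?_
      rw [Finset.mul_sum, Finset.sum_eq_single b]
      · exact hw.mul_self _ _
      · exact fun c _ hc => hw.row_orthogonal _ fun h => hc (congrArg Prod.fst h).symm
      · exact fun h => absurd (Finset.mem_univ b) h
    · change star (∑ b, w (a, i) (b, j)) = _
      rw [star_sum]
      exact Finset.sum_congr rfl fun b _ => hw.star_eq _ _
    · change ∑ j, ∑ b, w (a, i) (b, j) = 1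
      rw [← hw.row_sum (a, i), Fintype.sum_prod_type_right]
    · change ∑ i, ∑ b, w (a, i) (b, j) = 1
      -- The sum over i for fixed b is a column block; by preservation of the fibres it equals the
      -- row block v a b, and these add up to 1 over b.
      rw [Finset.sum_comm, ← hvm.row_sum a]
      refine Finset.sum_congr rfl fun b _ => ?_
      refine Eq.trans ?_ (rowBlock_eq_colBlock hw hB (a, i₀) (b, j)).symm
      rw [rowBlock, Finset.sum_filter, Fintype.sum_prod_type, Finset.sum_eq_single a]
      · simp
      · intro c _ hc
        simp [hc]
      · exact fun h => absurd (Finset.mem_univ a) h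
  have huY : ∀ a, Preserves (u a) Y.Adj Y.Adj := by
    intro a i j k l h0
    change (∑ b, w (a, i) (b, j)) * (∑ b, w (a, k) (b, l)) ≠ 0 at h0
    rw [Finset.sum_mul] at h0
    obtain ⟨b, -, h1⟩ := Finset.exists_ne_zero_of_sum_ne_zero h0
    rw [Finset.mul_sum] at h1
    obtain ⟨c, -, h2⟩ := Finset.exists_ne_zero_of_sum_ne_zero h1
    -- Both row indices lie in the fibre over a, so the column indices of a nonzero term share a
    -- fibre.
    have hbc : b = c := (hB _ _ _ _ h2).mp rfl
    subst hbc
    simpa [lexProd] using hZ _ _ _ _ h2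
  -- Multiplying by the block projection v a b keeps the summand with column in the fibre over b and
  -- kills the others.
  have huv : ∀ a b i j, u a i j * v a b = w (a, i) (b, j) := by
    intro a b i j
    rw [hv a b i]
    change (∑ c, w (a, i) (c, j)) * _ = _
    rw [Finset.sum_mul, Finset.sum_eq_single b]
    · exact entry_mul_rowBlock hw hB rfl rfl
    · exact fun c _ hc => entry_mul_rowBlock_eq_zero hw hB rfl hc
    · exact fun h => absurd (Finset.mem_univ b) h
  have hcomm : ∀ a b i j, Commute (u a i j) (v a b) := by
    intro a b i j
    -- A product of two self-adjoint elements that is itself self-adjoint is a product of commuting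
    -- elements.
    have h1 := congrArg star (huv a b i j)
    rw [star_mul, hw.star_eq, (hum a).star_eq, hvm.star_eq] at h1
    exact (huv a b i j).trans h1.symm
  choose φu hφu using fun a => qut_lift Y (hum a) (huY a)
  obtain ⟨φv, hφv⟩ := qut_lift X hvm hvX
  obtain ⟨φ, hφ⟩ := qut_lift Z (w := (wreathMatrix (Qut Y) (Qut X)).submatrix e e) (by
    have hm := wreathMatrix_magic (Qut Y) (Qut X)
    exact ⟨fun i j => hm.mul_self _ _, fun i j => hm.star_eq _ _,
      fun i => (e.toEquiv.sum_comp fun k => wreathMatrix (Qut Y) (Qut X) (e i) k).trans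
        (hm.row_sum _),
      fun j => (e.toEquiv.sum_comp fun k => wreathMatrix (Qut Y) (Qut X) k (e j)).trans
        (hm.col_sum _)⟩) (fun i j k l h0 => by
    have := wreathMatrix_preserves X Y _ _ _ _ h0
    rwa [e.map_adj_iff, e.map_adj_iff] at this)
  let T : WreathGen (Qut Y) (Qut X) → (Qut Z).C := Sum.elim (fun g => φu g.1 g.2) φv
  have hT := (wreathRels_iff (Qut Y) (Qut X) T).mpr ⟨fun a => (φu a).isUnitalStarHom,
    φv.isUnitalStarHom, fun a b i j => by
      change Commute (φu a _) (φv _)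
      rw [hφu, hφv]
      exact hcomm a b i j⟩
  have hψ : ∀ p q, (wreathPresentation (Qut Y) (Qut X)).lift T hT
      (wreathMatrix (Qut Y) (Qut X) p q) = w p q := by
    rintro ⟨a, i⟩ ⟨b, j⟩
    have h1 : (wreathPresentation (Qut Y) (Qut X)).lift T hT
        (wreathInl (Qut Y) (Qut X) a ((Qut Y).w i j)) = φu a ((Qut Y).w i j) :=
      (wreathPresentation (Qut Y) (Qut X)).lift_gen T hT (Sum.inl (a, (Qut Y).w i j))
    have h2 : (wreathPresentation (Qut Y) (Qut X)).lift T hT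
        (wreathInr (Qut Y) (Qut X) ((Qut X).w a b)) = φv ((Qut X).w a b) :=
      (wreathPresentation (Qut Y) (Qut X)).lift_gen T hT (Sum.inr ((Qut X).w a b))
    rw [wreathMatrix_apply, map_mul, h1, h2, hφu, hφv, huv]
  refine QuantumPermGroup.equal_of_homs (H := freeWreath (Qut Y) (Qut X)) φ
    ((wreathPresentation (Qut Y) (Qut X)).lift T hT) hφ fun i j => ?_
  refine (hψ _ _).trans ?_
  change (Qut Z).w (e.symm (e i)) (e.symm (e j)) = _
  rw [e.symm_apply_apply, e.symm_apply_apply]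

end Wreath

/-! ### Quantum isomorphisms from corners. -/

section Corner

variable {A : Type u} [CStarAlgebra A]

/-- The C*-seminorm `x ↦ ‖p * x‖` on the commutant of a projection `p`. -/
def cornerSeminorm (p : A) (hp : p * p = p) (hps : star p = p) :
    CStarSeminorm (StarSubalgebra.centralizer ℂ ({p} : Set A)) where
  toFun x := ‖p * x.1‖
  map_zero' := by simp
  add_le' x y := by simpa [mul_add] using norm_add_le (p * x.1) (p * y.1)
  neg' x := by simp
  smul' a x := by simp [norm_smul]
  mul_le' x y := by
    have hx : p * x.1 = x.1 * p := ((StarSubalgebra.mem_centralizer_iff ℂ).mp x.2 p rfl).1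
    have h : p * (x.1 * y.1) = p * x.1 * (p * y.1) := by
      rw [mul_assoc, ← mul_assoc x.1, ← hx, mul_assoc, ← mul_assoc p p, hp]
    exact (congrArg norm h).trans_le (norm_mul_le _ _)
  cstar' x := by
    have hx : p * x.1 = x.1 * p := ((StarSubalgebra.mem_centralizer_iff ℂ).mp x.2 p rfl).1
    have hx' : p * star x.1 = star x.1 * p := by
      have := congrArg star hx
      rw [star_mul, star_mul, hps] at this
      exact this.symm
    have h : p * (star x.1 * x.1) = star (p * x.1) * (p * x.1) := by
      rw [star_mul, hps, mul_assoc, ← mul_assoc p p, hp, ← mul_assoc, hx', mul_assoc]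
    change _ ≤ ‖p * (star x.1 * x.1)‖
    rw [h, CStarRing.norm_star_mul_self]

open Classical in
-- Inserting a row sum on the left and a column sum on the right turns both entries into sums of
-- products `w i j * w k l`, restricted by adjacency of i, k or of j, l. The two restrictions agree
-- on nonzero products.
theorem IsMagicUnitary.adjMatrix_mul {V W : Type u} [Fintype V] [Fintype W]
    {X : SimpleGraph V} {Y : SimpleGraph W} {w : Matrix V W A} (hw : IsMagicUnitary w)
    (h : Preserves w X.Adj Y.Adj) : X.adjMatrix A * w = w * Y.adjMatrix A := by
  ext i l
  have h1 : (X.adjMatrix A * w) i l = ∑ k, ∑ j, if X.Adj i k then w i j * w k l else 0 := by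
    rw [Matrix.mul_apply]
    refine Finset.sum_congr rfl fun k _ => ?_
    rw [SimpleGraph.adjMatrix_apply]
    split_ifs
    · rw [← Finset.sum_mul, hw.row_sum]
    · simp
  have h2 : (w * Y.adjMatrix A) i l = ∑ j, ∑ k, if Y.Adj j l then w i j * w k l else 0 := by
    rw [Matrix.mul_apply]
    refine Finset.sum_congr rfl fun k _ => ?_
    rw [SimpleGraph.adjMatrix_apply]
    split_ifs
    · rw [← Finset.mul_sum, hw.col_sum]
    · simp
  rw [h1, h2, Finset.sum_comm]
  refine Finset.sum_congr rfl fun j _ => Finset.sum_congr rfl fun k _ => ?_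
  by_cases h0 : w i j * w k l = 0
  · simp [h0]
  · rw [if_congr (h _ _ _ _ h0) rfl rfl]

/-- A matrix of projections with rows and columns adding up to a nonzero projection `p` defines a
quantum isomorphism. -/
theorem quantumIsomorphic_of_projection {V W : Type u} [Fintype V] [Fintype W]
    {X : SimpleGraph V} {Y : SimpleGraph W} {w : Matrix V W A} {p : A} (hp : p * p = p)
    (hps : star p = p) (hp0 : p ≠ 0) (hw : ∀ i j, w i j * w i j = w i j)
    (hws : ∀ i j, star (w i j) = w i j) (hpw : ∀ i j, p * w i j = w i j)
    (hrow : ∀ i, ∑ j, w i j = p) (hcol : ∀ j, ∑ i, w i j = p) (h : Preserves w X.Adj Y.Adj) :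
    QuantumIsomorphic X Y := by
  let q := cornerSeminorm p hp hps
  have hwp : ∀ i j, w i j * p = w i j := fun i j => by
    have := congrArg star (hpw i j)
    rwa [star_mul, hps, hws] at this
  have hmem : ∀ i j, w i j ∈ StarSubalgebra.centralizer ℂ ({p} : Set A) := by
    intro i j
    rw [StarSubalgebra.mem_centralizer_iff]
    rintro g rfl
    rw [hps, hpw, hwp]
    exact ⟨rfl, rfl⟩
  -- The completion only sees the corner p x. In particular p and 1 have the same image there, so
  -- row and column sums equal to p become sums equal to 1.
  have heq : ∀ x y : StarSubalgebra.centralizer ℂ ({p} : Set A), p * x.1 = p * y.1 →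
      q.toCompletion x = q.toCompletion y := by
    intro x y hxy
    rw [← sub_eq_zero, ← map_sub, ← norm_eq_zero, q.norm_toCompletion]
    change ‖p * (x.1 - y.1)‖ = 0
    rw [mul_sub, hxy, sub_self, norm_zero]
  let v : Matrix V W q.Completion := Matrix.of fun i j => q.toCompletion ⟨w i j, hmem i j⟩
  have hv : IsMagicUnitary v := by
    refine ⟨fun i j => ?_, fun i j => ?_, fun i => ?_, fun j => ?_⟩
    · change q.toCompletion _ * q.toCompletion _ = q.toCompletion _
      rw [← map_mul]
      exact congrArg _ (Subtype.ext (hw i j))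
    · change star (q.toCompletion _) = q.toCompletion _
      rw [← map_star]
      exact congrArg _ (Subtype.ext (hws i j))
    · change ∑ j, q.toCompletion _ = 1
      rw [← map_sum, ← map_one q.toCompletion]
      refine heq _ _ ?_
      rw [AddSubmonoidClass.coe_finsetSum, hrow, hp]
      exact (mul_one p).symm
    · change ∑ i, q.toCompletion _ = 1
      rw [← map_sum, ← map_one q.toCompletion]
      refine heq _ _ ?_
      rw [AddSubmonoidClass.coe_finsetSum, hcol, hp]
      exact (mul_one p).symm
  have hvXY : Preserves v X.Adj Y.Adj := by
    intro i j k l h0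
    refine h i j k l fun h1 => h0 ?_
    change q.toCompletion _ * q.toCompletion _ = 0
    rw [← map_mul, ← map_zero q.toCompletion]
    exact congrArg _ (Subtype.ext h1)
  -- The unit of the corner has seminorm ‖p‖, so the algebra is nonzero because p is.
  refine ⟨q.Completion, inferInstance, v, ⟨1, 0, fun h1 => hp0 ?_⟩, hv, hv.adjMatrix_mul hvXY⟩
  rw [← map_one q.toCompletion, ← norm_eq_zero, q.norm_toCompletion] at h1
  change ‖p * 1‖ = 0 at h1
  rwa [mul_one, norm_eq_zero] at h1

end Corner

/-! ### Connected components of a quantum vertex-transitive graph. -/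

section Components

variable {W A : Type u} [Fintype W] [CStarAlgebra A] {Y : SimpleGraph W} {w : Matrix W W A}

theorem preserves_component (hw : IsMagicUnitary w) (h : Preserves w Y.Adj Y.Adj) :
    Preserves w (fun y z => Y.connectedComponentMk y = Y.connectedComponentMk z)
      (fun y z => Y.connectedComponentMk y = Y.connectedComponentMk z) := by
  have h1 : ∀ y z, Y.connectedComponentMk y = Y.connectedComponentMk z ↔
      Relation.ReflTransGen Y.Adj y z := fun y z => by
    rw [SimpleGraph.ConnectedComponent.eq, SimpleGraph.reachable_iff_reflTransGen]
  exact (h.reflTransGen hw).of_iff h1 h1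

theorem sum_supp (c : Y.ConnectedComponent) [Fintype c.supp] (y : W) :
    ∑ z : c.supp, w y z = rowBlock w Y.connectedComponentMk y c := by
  classical
  rw [rowBlock]
  exact (Finset.sum_subtype _ (fun z => by simp [SimpleGraph.ConnectedComponent.mem_supp_iff])
    fun z => w y z).symm

/-- The block of the magic unitary of Qut(Y) with rows in c and columns in d has all its row and
column sums equal to one projection. This projection is a unit for the entries of the block, which
are nonzero by transitivity, so it is nonzero too. -/
theorem component_quantumIsomorphic (hY : IsQuantumVertexTransitive Y)
    (c d : Y.ConnectedComponent) [Fintype c.supp] [Fintype d.supp] :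
    QuantumIsomorphic c.toSimpleGraph d.toSimpleGraph := by
  have hw := (Qut Y).magic
  have hYw := qut_preserves Y
  have hc := preserves_component hw hYw
  obtain ⟨y, hy⟩ := c.nonempty_supp
  obtain ⟨z, hz⟩ := d.nonempty_supp
  have hpw : ∀ (i : c.supp) (j : d.supp),
      rowBlock (Qut Y).w Y.connectedComponentMk y d * (Qut Y).w i j = (Qut Y).w i j :=
    fun i j => rowBlock_mul_entry hw hc (hy.trans i.2.symm) j.2
  refine quantumIsomorphic_of_projection (w := (Qut Y).w.submatrix (fun i : c.supp => i.1)
    (fun j : d.supp => j.1)) (p := rowBlock (Qut Y).w Y.connectedComponentMk y d)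
    (rowBlock_mul_rowBlock hw hc d rfl) (rowBlock_star hw _ _) (fun h0 => ?_)
    (fun i j => hw.mul_self _ _) (fun i j => hw.star_eq _ _) hpw (fun i => ?_) (fun j => ?_)
    (fun i j k l h0 => hYw _ _ _ _ h0)
  · refine hY y z ?_
    have := hpw ⟨y, hy⟩ ⟨z, hz⟩
    rwa [h0, zero_mul, eq_comm] at this
  · exact (sum_supp d i.1).trans (rowBlock_congr hw hc d (i.2.trans hy.symm))
  · refine (sum_supp (w := (Qut Y).w.transpose) c j.1).trans ?_
    have h1 := rowBlock_eq_colBlock hw hc y j.1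
    have h2 : Y.connectedComponentMk j.1 = d := j.2
    have h3 : Y.connectedComponentMk y = c := hy
    rw [h2, h3] at h1
    exact h1.symm

/-- The diagonal block belonging to c has row and column sums p. It is completed to a magic unitary
by adding the identity matrix with coefficient 1 - p; multiplying an entry by p gives back the entry
of the block, which is nonzero. -/
theorem component_quantumVertexTransitive (hY : IsQuantumVertexTransitive Y)
    (c : Y.ConnectedComponent) [Fintype c.supp] : IsQuantumVertexTransitive c.toSimpleGraph := by
  classical
  have hw := (Qut Y).magic
  have hYw := qut_preserves Y
  have hc := preserves_component hw hYw
  obtain ⟨y, hy⟩ := c.nonempty_supp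
  let p := rowBlock (Qut Y).w Y.connectedComponentMk y c
  have hp : p * p = p := rowBlock_mul_rowBlock hw hc c rfl
  have hps : star p = p := rowBlock_star hw _ _
  have hpw : ∀ i j : c.supp, p * (Qut Y).w i j = (Qut Y).w i j :=
    fun i j => rowBlock_mul_entry hw hc (hy.trans i.2.symm) j.2
  have hwp : ∀ i j : c.supp, (Qut Y).w i j * p = (Qut Y).w i j :=
    fun i j => entry_mul_rowBlock hw hc (hy.trans i.2.symm) j.2
  let v : Matrix c.supp c.supp (Qut Y).C :=
    Matrix.of fun i j => (Qut Y).w i j + if i = j then 1 - p else 0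
  -- The block lives under p and the added identity under 1 - p, so the mixed terms vanish.
  have hvv : ∀ i j k l, v i j * v k l =
      (Qut Y).w i j * (Qut Y).w k l + if i = j ∧ k = l then 1 - p else 0 := by
    intro i j k l
    have e1 : (1 - p) * (1 - p) = 1 - p := by rw [sub_mul, mul_sub, mul_sub, hp]; simp
    have e2 : (Qut Y).w i j * (1 - p) = 0 := by rw [mul_sub, hwp, mul_one, sub_self]
    have e3 : (1 - p) * (Qut Y).w k l = 0 := by rw [sub_mul, hpw, one_mul, sub_self]
    change ((Qut Y).w i j + _) * ((Qut Y).w k l + _) = _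
    by_cases h1 : i = j <;> by_cases h2 : k = l <;> simp [h1, h2, add_mul, mul_add, e1] <;>
      simp_all
  refine isQuantumVertexTransitive_of (w := v) ⟨fun i j => ?_, fun i j => ?_, fun i => ?_,
    fun j => ?_⟩ (fun i j k l h0 => ?_) (fun i j h0 => hY i j ?_)
  · rw [hvv, hw.mul_self]
    simp only [and_self]
    rfl
  · change star ((Qut Y).w i j + _) = (Qut Y).w i j + _
    rw [star_add, hw.star_eq]
    split_ifs
    · rw [star_sub, star_one, hps]
    · rw [star_zero]
  · change ∑ j : c.supp, ((Qut Y).w i j + _) = 1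
    rw [Finset.sum_add_distrib, sum_supp, Finset.sum_ite_eq, if_pos (Finset.mem_univ i),
      rowBlock_congr hw hc c (i.2.trans hy.symm)]
    exact add_sub_cancel _ _
  · change ∑ i : c.supp, ((Qut Y).w i j + _) = 1
    have h1 := rowBlock_eq_colBlock hw hc y j.1
    have h2 : Y.connectedComponentMk j.1 = c := j.2
    have h3 : Y.connectedComponentMk y = c := hy
    rw [h2, h3, ← sum_supp (w := (Qut Y).w.transpose) c j.1] at h1
    rw [Finset.sum_add_distrib, Finset.sum_ite_eq', if_pos (Finset.mem_univ j)]
    refine (congrArg (· + (1 - p)) h1.symm).trans ?_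
    exact add_sub_cancel _ _
  · rw [hvv] at h0
    -- If the part under p vanishes, only the identity part can contribute; then i = j and k = l,
    -- and nothing has to be shown.
    by_cases h1 : (Qut Y).w i j * (Qut Y).w k l = 0
    · rw [h1, zero_add, ne_eq, ite_eq_right_iff, Classical.not_imp] at h0
      rw [h0.1.1, h0.1.2]
    · exact hYw _ _ _ _ h1
  · have h1 : p * v i j = 0 := by rw [h0, mul_zero]
    change p * ((Qut Y).w i j + _) = 0 at h1
    rw [mul_add, hpw] at h1
    split_ifs at h1
    · rwa [mul_sub, hp, mul_one, sub_self, add_zero] at h1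
    · rwa [mul_zero, add_zero] at h1

/-- A graph is the disjoint union of its connected components. -/
noncomputable def componentsIso (Y : SimpleGraph W) {ι : Type*} (E : ι ≃ Y.ConnectedComponent) :
    Y ≃g disjUnion fun i => (E i).toSimpleGraph :=
  RelIso.symm
    { toEquiv := Equiv.ofBijective (fun p : Σ i, (E i).supp => p.2.1) (by
        constructor
        · rintro ⟨i, y, hy⟩ ⟨j, z, hz⟩ (rfl : y = z)
          have hij : i = j := E.injective ((hy : _ = E i).symm.trans hz)
          subst hij
          rfl
        · intro y
          refine ⟨⟨E.symm (Y.connectedComponentMk y), y, ?_⟩, rfl⟩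
          rw [E.apply_symm_apply]
          rfl)
      map_rel_iff' := by
        rintro ⟨i, y, hy⟩ ⟨j, z, hz⟩
        change Y.Adj y z ↔ ∃ _, _
        constructor
        · intro h
          have hij : i = j := E.injective ((hy : _ = E i).symm.trans
            ((SimpleGraph.ConnectedComponent.eq.mpr h.reachable).trans hz))
          subst hij
          exact ⟨i, ⟨y, hy⟩, ⟨z, hz⟩, rfl, rfl, h⟩
        · rintro ⟨k, a, b, h1, h2, h⟩
          cases h1
          cases h2
          exact h }

end Components

/-! ### Twin classes and the twin-free quotient. -/

section Twins

variable {V : Type u}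

/-- Twins, or equal vertices. -/
def twinSetoid (X : SimpleGraph V) : Setoid V := Setoid.ker X.neighborSet

theorem twin_adj_left {X : SimpleGraph V} {x x' y : V} (h : X.neighborSet x = X.neighborSet x') :
    X.Adj x y ↔ X.Adj x' y := Set.ext_iff.mp h y

theorem twin_adj_right {X : SimpleGraph V} {x y y' : V}
    (h : X.neighborSet y = X.neighborSet y') : X.Adj x y ↔ X.Adj x y' := by
  rw [X.adj_comm, X.adj_comm x]
  exact twin_adj_left h

/-- The graph of twin classes. -/
def twinQuotient (X : SimpleGraph V) : SimpleGraph (Quotient (twinSetoid X)) where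
  Adj := Quotient.lift₂ X.Adj fun _ _ _ _ h1 h2 =>
    propext ((twin_adj_left h1).trans (twin_adj_right h2))
  symm := ⟨by
    rintro ⟨x⟩ ⟨y⟩ h
    exact X.adj_symm h⟩
  loopless := ⟨by
    rintro ⟨x⟩ h
    exact X.loopless.irrefl x h⟩

theorem twin_mk_eq {X : SimpleGraph V} {x y : V} :
    (Quotient.mk (twinSetoid X) x = Quotient.mk _ y) ↔ X.neighborSet x = X.neighborSet y :=
  Quotient.eq

/-- A vertex z is a neighbour of x exactly when its class is a neighbour of the class of x, so
classes with equal neighbourhoods have twin representatives. -/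
theorem twinQuotient_hasNoTwins (X : SimpleGraph V) : HasNoTwins (twinQuotient X) := by
  rintro ⟨x⟩ ⟨y⟩ h
  refine twin_mk_eq.mpr (Set.ext fun z => ?_)
  exact Set.ext_iff.mp h (Quotient.mk _ z)

variable [Fintype V] {A : Type u} [CStarAlgebra A] {X : SimpleGraph V}

theorem preserves_twin {w : Matrix V V A} (hw : IsMagicUnitary w) (h : Preserves w X.Adj X.Adj) :
    Preserves w
      (fun x y => Quotient.mk (twinSetoid X) x = Quotient.mk _ y)
      (fun x y => Quotient.mk (twinSetoid X) x = Quotient.mk _ y) := by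
  -- Failure to be twins means that some s is adjacent to exactly one of x and y: a two-step path
  -- with one step an edge and the other a non-edge, in one of the two orders.
  have h1 : ∀ x y, Quotient.mk (twinSetoid X) x = Quotient.mk _ y ↔
      ¬ ((∃ s, X.Adj x s ∧ ¬ X.Adj s y) ∨ (∃ s, ¬ X.Adj x s ∧ X.Adj s y)) := by
    intro x y
    rw [twin_mk_eq, Set.ext_iff]
    simp only [SimpleGraph.mem_neighborSet, X.adj_comm _ y]
    push Not
    constructor
    · exact fun h => ⟨fun s hs => (h s).mp hs, fun s hs h' => hs ((h s).mpr h')⟩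
    · exact fun h s => ⟨h.1 s, fun h' => by_contra fun hs => h.2 s hs h'⟩
  exact ((h.comp hw h.not).or (h.not.comp hw h)).not.of_iff h1 h1

open Classical in
-- A closed two-step path at x inside the twin relation is a choice of an element of the class of x.
-- Since w x y * w x y = w x y ≠ 0, such paths at x and at y are equally many.
theorem card_twinClass (hX : IsQuantumVertexTransitive X) (x y : V) :
    (Finset.univ.filter fun s => Quotient.mk (twinSetoid X) s = Quotient.mk _ x).card =
      (Finset.univ.filter fun s => Quotient.mk (twinSetoid X) s = Quotient.mk _ y).card := by
  have hw := (Qut X).magic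
  have h := preserves_twin hw (qut_preserves X)
  have h1 := h.card_comp hw h (i := x) (j := y) (k := x) (l := y)
    (by rw [hw.mul_self]; exact hX x y)
  have h2 : ∀ a b : V, (Quotient.mk (twinSetoid X) a = Quotient.mk _ b ∧
      Quotient.mk (twinSetoid X) b = Quotient.mk _ a) ↔
      Quotient.mk (twinSetoid X) b = Quotient.mk _ a := fun a b =>
    and_iff_right_of_imp Eq.symm
  simpa only [h2] using h1

open Classical in
-- Closed two-step walks at a vertex correspond to its neighbours, and w x y ≠ 0 forces equal
-- numbers at x and at y.
theorem degree_eq (hX : IsQuantumVertexTransitive X) (x y : V) :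
    (Finset.univ.filter fun s => X.Adj x s).card =
      (Finset.univ.filter fun s => X.Adj y s).card := by
  have hw := (Qut X).magic
  have h := qut_preserves X
  have h1 := h.card_comp hw h (i := x) (j := y) (k := x) (l := y)
    (by rw [hw.mul_self]; exact hX x y)
  have h2 : ∀ a b : V, (X.Adj a b ∧ X.Adj b a) ↔ X.Adj a b := fun a b =>
    and_iff_left_of_imp fun h => h.symm
  simpa only [h2] using h1

theorem twinQuotient_quantumVertexTransitive [Fintype (Quotient (twinSetoid X))]
    (hX : IsQuantumVertexTransitive X) : IsQuantumVertexTransitive (twinQuotient X) := by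
  classical
  have hw := (Qut X).magic
  have h := preserves_twin hw (qut_preserves X)
  refine isQuantumVertexTransitive_of (quotient_magic hw h (σ := Quotient.out) Quotient.out_eq
    (τ := Quotient.out) Quotient.out_eq) (quotient_preserves Quotient.out_eq
    (R := (twinQuotient X).Adj) (R' := (twinQuotient X).Adj) (qut_preserves X))
    fun c d h0 => hX c.out d.out ?_
  -- An entry is fixed by multiplication with its block, so a zero block would force a zero entry of
  -- the magic unitary of Qut(X).
  rw [← entry_mul_rowBlock hw h (i := c.out) (d := d) rfl (Quotient.out_eq d)]
  exact (congrArg _ h0).trans (mul_zero _)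

open Classical in
theorem exists_twinIso (α : ℕ) (hα : ∀ x : V,
    (Finset.univ.filter fun s => Quotient.mk (twinSetoid X) s = Quotient.mk _ x).card = α) :
    ∃ e : X ≃g lexProd (twinQuotient X) (⊥ : SimpleGraph (Fin α)),
      ∀ x, (e x).1 = Quotient.mk _ x := by
  have h1 : ∀ c : Quotient (twinSetoid X),
      Nonempty ({x : V // Quotient.mk (twinSetoid X) x = c} ≃ Fin α) := by
    intro c
    obtain ⟨x, rfl⟩ := Quotient.exists_rep c
    refine ⟨Fintype.equivFinOfCardEq ?_⟩
    rw [Fintype.card_subtype]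
    exact hα x
  let F := fun c => (h1 c).some
  let e : V ≃ Quotient (twinSetoid X) × Fin α :=
    (Equiv.sigmaFiberEquiv (Quotient.mk (twinSetoid X))).symm.trans
      ((Equiv.sigmaCongrRight F).trans (Equiv.sigmaEquivProd _ _))
  refine ⟨⟨e, ?_⟩, fun x => rfl⟩
  intro x y
  -- Adjacency of the classes of x and y is by definition adjacency of x and y, and the edgeless
  -- fibre contributes nothing.
  change X.Adj x y ∨ (_ ∧ False) ↔ _
  simp

end Twins

/-! ### Definable fibres of a lexicographic product. -/

section LexProd

variable {V W A : Type u} [Fintype V] [Fintype W] [CStarAlgebra A]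
  {X : SimpleGraph V} {Y : SimpleGraph W}

open Classical in
/-- Nonadjacent vertices with at least `d` common neighbours. -/
def manyCommon {S : Type u} [Fintype S] (Z : SimpleGraph S) (d : ℕ) (p q : S) : Prop :=
  ¬ Z.Adj p q ∧ d ≤ (Finset.univ.filter fun s => Z.Adj p s ∧ Z.Adj s q).card

open Classical in
-- Every vertex lying over a neighbour of x is a common neighbour, which gives the threshold. Twins
-- are never adjacent, so adjacency could only come from a common fibre; `hy` excludes that.
theorem manyCommon_of_twin {x x' : V} {y y' : W} (h : X.neighborSet x = X.neighborSet x')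
    (hy : x = x' → ¬ Y.Adj y y') :
    manyCommon (lexProd X Y)
      ((Finset.univ.filter fun s => X.Adj x s).card * Fintype.card W) (x, y) (x', y') := by
  constructor
  · rintro (h1 | ⟨h1, h2⟩)
    · exact X.loopless.irrefl _ ((twin_adj_left h).mp h1)
    · exact hy h1 h2
  · rw [← Finset.card_univ, ← Finset.card_product]
    refine Finset.card_le_card fun s hs => ?_
    have hs : X.Adj x s.1 := by simpa using hs
    simpa using ⟨Or.inl hs, Or.inl ((twin_adj_left h).mp hs).symm⟩

/-- If the fibres over the twin classes are preserved and `Y` is connected, then the fibres over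
the vertices are preserved. -/
theorem preserves_lexProd_fst_of_connected {w : Matrix (V × W) (V × W) A}
    (hw : IsMagicUnitary w) (hZ : Preserves w (lexProd X Y).Adj (lexProd X Y).Adj)
    (h : Preserves w (fun p q => Quotient.mk (twinSetoid X) (Prod.fst p) = Quotient.mk _ q.1)
      (fun p q => Quotient.mk (twinSetoid X) (Prod.fst p) = Quotient.mk _ q.1))
    (hY : Y.Connected) :
    Preserves w (fun p q => Prod.fst p = q.1) (fun p q => Prod.fst p = q.1) := by
  -- Twins are not adjacent, so an edge inside a twin fibre stays over a single vertex, where the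
  -- graph is a copy of the connected graph Y.
  have h1 : ∀ p q : V × W, p.1 = q.1 ↔ Relation.ReflTransGen (fun p q => (lexProd X Y).Adj p q ∧
      Quotient.mk (twinSetoid X) (Prod.fst p) = Quotient.mk _ q.1) p q := by
    rintro ⟨x, y⟩ ⟨x', y'⟩
    constructor
    · rintro (rfl : x = x')
      refine Relation.ReflTransGen.lift (fun y => (x, y)) (fun a b hab => ?_) _ _
        ((SimpleGraph.reachable_iff_reflTransGen y y').mp (hY.preconnected y y'))
      exact ⟨Or.inr ⟨rfl, hab⟩, rfl⟩
    · intro h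
      generalize ((x, y) : V × W) = p at h ⊢
      generalize ((x', y') : V × W) = q at h ⊢
      induction h with
      | refl => rfl
      | tail _ h ih =>
        refine ih.trans ?_
        obtain ⟨h1 | h1, h2⟩ := h
        · exact absurd ((twin_adj_left (twin_mk_eq.mp h2)).mp h1) (X.loopless.irrefl _)
        · exact h1.1
  exact ((hZ.and h).reflTransGen hw).of_iff h1 h1

variable [Nonempty W]

open Classical in
-- If p and q lie over different vertices, these are not adjacent, and all common neighbours of p
-- and q lie over common neighbours of the two. The threshold then forces d common neighbours in the
-- d-regular graph X, that is, equal neighbourhoods.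
theorem twin_of_manyCommon {d : ℕ} (hd : ∀ x, (Finset.univ.filter fun s => X.Adj x s).card = d)
    {p q : V × W} (h : manyCommon (lexProd X Y) (d * Fintype.card W) p q) :
    X.neighborSet p.1 = X.neighborSet q.1 := by
  by_cases hpq : p.1 = q.1
  · rw [hpq]
  obtain ⟨h1, h2⟩ := h
  have hX : ¬ X.Adj p.1 q.1 := fun h => h1 (Or.inl h)
  have h3 : (Finset.univ.filter fun s => (lexProd X Y).Adj p s ∧ (lexProd X Y).Adj s q) ⊆
      (Finset.univ.filter fun s => X.Adj p.1 s ∧ X.Adj s q.1) ×ˢ Finset.univ := by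
    intro s hs
    obtain ⟨ha, hb⟩ := (Finset.mem_filter.mp hs).2
    simp only [Finset.mem_product, Finset.mem_filter, Finset.mem_univ, true_and, and_true]
    rcases ha with ha | ⟨ha, -⟩ <;> rcases hb with hb | ⟨hb, -⟩
    · exact ⟨ha, hb⟩
    · exact absurd (hb ▸ ha) hX
    · exact absurd (ha ▸ hb) hX
    · exact absurd (ha.trans hb) hpq
  have h4 := h2.trans (Finset.card_le_card h3)
  rw [Finset.card_product, Finset.card_univ] at h4
  have h5 := Nat.le_of_mul_le_mul_right h4 Fintype.card_pos
  have h6 := Finset.eq_of_subset_of_card_le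
    (s := Finset.univ.filter fun s => X.Adj p.1 s ∧ X.Adj s q.1)
    (t := Finset.univ.filter fun s => X.Adj p.1 s)
    (fun s hs => by simpa using (Finset.mem_filter.mp hs).2.1) (by rwa [hd])
  have h7 := Finset.eq_of_subset_of_card_le
    (s := Finset.univ.filter fun s => X.Adj p.1 s ∧ X.Adj s q.1)
    (t := Finset.univ.filter fun s => X.Adj q.1 s)
    (fun s hs => by simpa using (Finset.mem_filter.mp hs).2.2.symm) (by rwa [hd])
  ext s
  simpa using Finset.ext_iff.mp (h6.symm.trans h7) s

open Classical in
-- Different twins are related in a single step. Within one fibre a step is available along each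
-- edge of the complement of Y, whose connectedness links the whole fibre.
theorem reflTransGen_manyCommon_iff {d : ℕ} (hYc : Yᶜ.Connected)
    (hd : ∀ x, (Finset.univ.filter fun s => X.Adj x s).card = d) (p q : V × W) :
    Relation.ReflTransGen (manyCommon (lexProd X Y) (d * Fintype.card W)) p q ↔
      X.neighborSet p.1 = X.neighborSet q.1 := by
  constructor
  · intro h
    induction h with
    | refl => rfl
    | tail _ h ih => exact ih.trans (twin_of_manyCommon hd h)
  · obtain ⟨x, y⟩ := p
    obtain ⟨x', y'⟩ := q
    intro h
    by_cases hx : x = x'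
    · subst hx
      have h1 := (SimpleGraph.reachable_iff_reflTransGen y y').mp (hYc.preconnected y y')
      refine Relation.ReflTransGen.lift (fun y => (x, y)) (fun a b hab => ?_) _ _ h1
      rw [← hd x]
      exact manyCommon_of_twin rfl fun _ => ((SimpleGraph.compl_adj _ _ _).mp hab).2
    · rw [← hd x]
      exact .single (manyCommon_of_twin h fun h' => absurd h' hx)

theorem preserves_manyCommon {S : Type u} [Fintype S] {Z : SimpleGraph S} {w : Matrix S S A}
    (hw : IsMagicUnitary w) (h : Preserves w Z.Adj Z.Adj) (d : ℕ) :
    Preserves w (manyCommon Z d) (manyCommon Z d) := by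
  classical
  intro i j k l h0
  rw [manyCommon, manyCommon, h _ _ _ _ h0, h.card_comp hw h h0]

/-- If the complement of `Y` is connected, then the quantum automorphisms of `X[Y]` preserve the
fibres over the twin classes of `X`. -/
theorem preserves_lexProd_twin (hX : IsQuantumVertexTransitive X) (hYc : Yᶜ.Connected) :
    Preserves (Qut (lexProd X Y)).w
      (fun p q => Quotient.mk (twinSetoid X) (Prod.fst p) = Quotient.mk _ q.1)
      (fun p q => Quotient.mk (twinSetoid X) (Prod.fst p) = Quotient.mk _ q.1) := by
  classical
  rcases isEmpty_or_nonempty V with hV | ⟨⟨x⟩⟩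
  · exact fun i => isEmptyElim i.1
  -- The threshold is the common degree of X times the number of vertices of Y; the degree is read
  -- off at an arbitrary vertex x.
  have h := (preserves_manyCommon (Qut (lexProd X Y)).magic (qut_preserves _)
    ((Finset.univ.filter fun s => X.Adj x s).card * Fintype.card W)).reflTransGen
    (Qut (lexProd X Y)).magic
  have h1 := fun p q => twin_mk_eq.trans
    (reflTransGen_manyCommon_iff (X := X) (Y := Y) hYc (fun x' => degree_eq hX x' x) p q).symm
  exact h.of_iff h1 h1

/-- Regrouping as an isomorphism of lexicographic products. -/
def regroupIso {V' W' P K : Type*} {ι : Type*} {U : ι → Type*} {X : SimpleGraph V'}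
    {Y : SimpleGraph W'} {X' : SimpleGraph P} {Yc : ∀ i, SimpleGraph (U i)}
    (eX : X ≃g lexProd X' (⊥ : SimpleGraph K)) (eY : Y ≃g disjUnion Yc) :
    lexProd X Y ≃g lexProd X' (disjUnion fun i => lexProd (⊥ : SimpleGraph K) (Yc i)) where
  toEquiv := (Equiv.prodCongr eX.toEquiv eY.toEquiv).trans (regroup P K U)
  map_rel_iff' := by
    rintro ⟨x, y⟩ ⟨x', y'⟩
    -- Blowing up each component amounts to blowing up Y itself: an edge is an edge of Y with equal
    -- first labels.
    have hY : ∀ a b, (disjUnion fun i => lexProd (⊥ : SimpleGraph K) (Yc i)).Adj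
        ⟨(eY y).1, a, (eY y).2⟩ ⟨(eY y').1, b, (eY y').2⟩ ↔ a = b ∧ Y.Adj y y' := by
      intro a b
      rw [← eY.map_adj_iff]
      generalize eY y = s
      generalize eY y' = t
      obtain ⟨i, s⟩ := s
      obtain ⟨j, t⟩ := t
      constructor
      · rintro ⟨k, c, d, h1, h2, h⟩
        cases h1
        cases h2
        have h := h.resolve_left id
        exact ⟨h.1, _, _, _, rfl, rfl, h.2⟩
      · rintro ⟨rfl, k, c, d, h1, h2, h⟩
        cases h1
        cases h2
        exact ⟨_, _, _, rfl, rfl, Or.inr ⟨rfl, h⟩⟩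
    change X'.Adj (eX x).1 (eX x').1 ∨ (eX x).1 = (eX x').1 ∧
      (disjUnion fun i => lexProd (⊥ : SimpleGraph K) (Yc i)).Adj
        ⟨(eY y).1, (eX x).2, (eY y).2⟩ ⟨(eY y').1, (eX x').2, (eY y').2⟩ ↔
      X.Adj x x' ∨ x = x' ∧ Y.Adj y y'
    rw [hY, ← eX.map_adj_iff, ← and_assoc, ← Prod.ext_iff, eX.injective.eq_iff]
    refine or_congr ?_ Iff.rfl
    exact ⟨Or.inl, fun h => h.resolve_right fun h' => h'.2⟩

end LexProd

/-! ### The two decompositions and the conclusion. -/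

theorem equal_freeWreath_regroup {V W P : Type u} {ι K : Type} {U : ι → Type u} [Fintype V] [Fintype W]
    [Fintype P] [Fintype ι] [Fintype K] [∀ i, Fintype (U i)] [Nonempty (Σ i, K × U i)] {X : SimpleGraph V}
    {Y : SimpleGraph W} {X' : SimpleGraph P} {Yc : ∀ i, SimpleGraph (U i)}
    (eX : X ≃g lexProd X' (⊥ : SimpleGraph K)) (eY : Y ≃g disjUnion Yc)
    (h : Preserves (Qut (lexProd X Y)).w (fun p q => (eX (Prod.fst p)).1 = (eX q.1).1)
      (fun p q => (eX (Prod.fst p)).1 = (eX q.1).1)) :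
    (Qut (lexProd X Y)).Equal
      ((Equiv.prodCongr eX.toEquiv eY.toEquiv).trans (regroup P K U))
      (freeWreath (Qut (disjUnion fun i => lexProd (⊥ : SimpleGraph K) (Yc i))) (Qut X')) :=
  equal_freeWreath (lexProd X Y) X' (disjUnion fun i => lexProd (⊥ : SimpleGraph K) (Yc i))
    (regroupIso eX eY) h

/-- A quantum vertex-transitive graph is a blow-up of a quantum vertex-transitive graph without
twins. -/
theorem exists_twin_decomposition {V : Type u} [Fintype V] [Nonempty V] {X : SimpleGraph V}
    (hX : IsQuantumVertexTransitive X) :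
    ∃ (α : ℕ) (P : Type u) (_ : Fintype P) (X' : SimpleGraph P)
      (eX : X ≃g lexProd X' (⊥ : SimpleGraph (Fin α))),
      IsQuantumVertexTransitive X' ∧ HasNoTwins X' ∧
        ∀ x y, (eX x).1 = (eX y).1 ↔ X.neighborSet x = X.neighborSet y := by
  classical
  obtain ⟨x₀⟩ := ‹Nonempty V›
  -- The number α is the size of the twin class of x₀, which is the size of every twin class.
  obtain ⟨eX, heX⟩ := exists_twinIso (X := X) _ fun x => card_twinClass hX x x₀
  refine ⟨_, _, inferInstance, _, eX, twinQuotient_quantumVertexTransitive hX,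
    twinQuotient_hasNoTwins X, fun x y => ?_⟩
  rw [heX, heX, twin_mk_eq]

/-- A quantum vertex-transitive graph is the disjoint union of connected, pairwise quantum
isomorphic, quantum vertex-transitive graphs. -/
theorem exists_component_decomposition {W : Type u} [Fintype W] [Nonempty W] {Y : SimpleGraph W}
    (hY : IsQuantumVertexTransitive Y) :
    ∃ (β : ℕ) (U : Fin β → Type u) (_ : ∀ i, Fintype (U i)) (Yc : ∀ i, SimpleGraph (U i))
      (_ : Y ≃g disjUnion Yc),
      (¬ Y.Connected → 1 < β) ∧ (∀ i, (Yc i).Connected) ∧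
        (∀ i, IsQuantumVertexTransitive (Yc i)) ∧ ∀ i j, QuantumIsomorphic (Yc i) (Yc j) := by
  classical
  refine ⟨Fintype.card Y.ConnectedComponent, _, fun i => Fintype.ofFinite _, _,
    componentsIso Y (Fintype.equivFin _).symm, fun hYd => ?_,
    fun i => SimpleGraph.ConnectedComponent.connected_toSimpleGraph _,
    fun i => @component_quantumVertexTransitive _ _ _ hY _ (Fintype.ofFinite _),
    fun i j => @component_quantumIsomorphic _ _ _ hY _ _ (Fintype.ofFinite _)
      (Fintype.ofFinite _)⟩
  rw [Fintype.one_lt_card_iff]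
  by_contra! h
  -- With at most one component any two vertices are reachable from each other.
  exact hYd ⟨fun y z => SimpleGraph.ConnectedComponent.eq.mp (h _ _)⟩

theorem mainTheorem6 {V W : Type u} [Fintype V] [Fintype W] [Nonempty V] [Nonempty W]
    (X : SimpleGraph V) (Y : SimpleGraph W)
    (hX : IsQuantumVertexTransitive X) (hY : IsQuantumVertexTransitive Y)
    (hne : ¬ (Qut (lexProd X Y)).Equal (Equiv.refl (V × W)) (freeWreath (Qut Y) (Qut X)))
    (hYc : Yᶜ.Connected) :
    ∃ (β : ℕ) (U : Fin β → Type u) (_ : ∀ i, Fintype (U i)) (Yc : ∀ i, SimpleGraph (U i))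
      (eY : Y ≃g disjUnion Yc)
      (α : ℕ) (P : Type u) (_ : Fintype P) (X' : SimpleGraph P)
      (eX : X ≃g lexProd X' (⊥ : SimpleGraph (Fin α)))
      (_ : Nonempty (Σ i, Fin α × U i)),
      1 < β ∧ (∀ i, (Yc i).Connected) ∧ (∀ i, IsQuantumVertexTransitive (Yc i)) ∧
      (∀ i j, QuantumIsomorphic (Yc i) (Yc j)) ∧
      1 < α ∧ IsQuantumVertexTransitive X' ∧ HasNoTwins X' ∧
      (Qut (lexProd X Y)).Equal
        ((Equiv.prodCongr eX.toEquiv eY.toEquiv).trans (regroup P (Fin α) U))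
        (freeWreath (Qut (disjUnion fun i => lexProd (⊥ : SimpleGraph (Fin α)) (Yc i)))
          (Qut X')) := by
  have hT := preserves_lexProd_twin hX hYc
  -- The inequality of quantum groups enters only here: the fibres over the vertices of X cannot be
  -- preserved.
  have hB : ¬ Preserves (Qut (lexProd X Y)).w (fun p q => Prod.fst p = q.1)
      (fun p q => Prod.fst p = q.1) := fun h =>
    hne (equal_freeWreath (lexProd X Y) X Y (RelIso.refl _) h)
  have hYd : ¬ Y.Connected := fun h =>
    hB (preserves_lexProd_fst_of_connected (Qut (lexProd X Y)).magic (qut_preserves _) hT h)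
  have hXt : ∃ x x', X.neighborSet x = X.neighborSet x' ∧ x ≠ x' := by
    by_contra! h
    -- Without twins the twin fibres are the fibres over vertices.
    refine hB (hT.of_iff ?_ ?_) <;>
      exact fun p q => ⟨fun h => by rw [h], fun h' => h _ _ (twin_mk_eq.mp h')⟩
  obtain ⟨x₀, x₁, hx, hx01⟩ := hXt
  obtain ⟨β, U, fU, Yc, eY, hβ, hc, hqt, hqi⟩ := exists_component_decomposition hY
  obtain ⟨α, P, fP, X', eX, hX', hX't, heX⟩ := exists_twin_decomposition hX
  have hα : 1 < α := by
    -- The distinct twins x₀ and x₁ have the same class, so their labels in `Fin α` differ.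
    have h01 : (eX x₀).2 ≠ (eX x₁).2 := fun h =>
      hx01 (eX.injective (Prod.ext ((heX _ _).mpr hx) h))
    simpa using Fintype.one_lt_card_iff.mpr ⟨_, _, h01⟩
  obtain ⟨y₀⟩ := ‹Nonempty W›
  have hn : Nonempty (Σ i, Fin α × U i) := ⟨⟨(eY y₀).1, (eX x₀).2, (eY y₀).2⟩⟩
  have hiff : ∀ p q : V × W, (eX p.1).1 = (eX q.1).1 ↔
      Quotient.mk (twinSetoid X) p.1 = Quotient.mk _ q.1 :=
    fun p q => (heX _ _).trans twin_mk_eq.symm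
  have : Nonempty W := ⟨y₀⟩
  exact ⟨β, U, fU, Yc, eY, α, P, fP, X', eX, hn, hβ hYd, hc, hqt, hqi, hα, hX', hX't,
    equal_freeWreath_regroup eX eY (hT.of_iff hiff hiff)⟩
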